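/- Let $n\ge 3$, let $M$ be a smooth $n$-dimensional manifold and let $g(t)$, $t\in I$, be a smooth Ricci flow on $M$ over a time interval $I\subset\mathbb R$ with more than one point, that is, a family of Riemannian metrics, smooth in time and space jointly, with $\partial_t g_{ij}=-2\,\mathrm R_{ij}$ (at an end point of $I$ that belongs to $I$, $\partial_t$ is the one-sided derivative). Repeated indices are summed. For a Riemannian metric $g$ with Levi-Civita connection $\nabla$ let $$\mathrm{Riem}(X,Y)Z=\nabla_Y\nabla_XZ-\nabla_X\nabla_YZ+\nabla_{[X,Y]}Z,$$ and in local coordinates let $\mathrm R^l_{ijk}\,\partial_l=\mathrm{Riem}(\partial_i,\partial_j)\partial_k$, $\mathrm R_{ijkl}=g_{lm}\mathrm R^m_{ijk}$, $\mathrm R_{ik}=g^{jl}\mathrm R_{ijkl}$, $\mathrm R=g^{ik}\mathrm R_{ik}$, $|\mathrm{Ric}|^2=g^{ip}g^{jq}\mathrm R_{ij}\mathrm R_{pq}$, and let the Weyl tensor be $$\mathrm W_{ijkl}=\mathrm R_{ijkl}+\frac{\mathrm R}{(n-1)(n-2)}(g_{ik}g_{jl}-g_{il}g_{jk})-\frac1{n-2}(\mathrm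 R_{ik}g_{jl}-\mathrm R_{il}g_{jk}+\mathrm R_{jl}g_{ik}-\mathrm R_{jk}g_{il}).$$ Put $\mathrm D_{ijkl}=g^{pq}g^{rs}\mathrm W_{pijr}\mathrm W_{slkq}$ and $\Delta=g^{pq}\nabla_p\nabla_q$. Then in every smooth coordinate chart of $M$ (independent of time), at every point of the chart, at every time $t\in I$, and for all indices $i,j,k,l$, the component $\mathrm W_{ijkl}$ of the Weyl tensor of $g(t)$ is differentiable in time and \begin{align*} (\partial_t-\Delta)\mathrm W_{ijkl}=\;&2(\mathrm D_{ijkl}-\mathrm D_{ijlk}+\mathrm D_{ikjl}-\mathrm D_{iljk})\\ &-g^{pq}(\mathrm R_{ip}\mathrm W_{qjkl}+\mathrm R_{jp}\mathrm W_{iqkl}+\mathrm R_{kp}\mathrm W_{ijql}+\mathrm R_{lp}\mathrm W_{ijkq})\\ &+\frac{2}{(n-2)^2}g^{pq}(\mathrm R_{ip}\mathrm R_{qk}g_{jl}-\mathrm R_{ip}\mathrm R_{ql}g_{jk}+\mathrm R_{jp}\mathrm R_{ql}g_{ik}-\mathrm R_{jp}\mathrm R_{qk}g_{il})\\ &-\frac{2\mathrm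 R}{(n-2)^2}(\mathrm R_{ik}g_{jl}-\mathrm R_{il}g_{jk}+\mathrm R_{jl}g_{ik}-\mathrm R_{jk}g_{il})\\ &+\frac{2}{n-2}(\mathrm R_{ik}\mathrm R_{jl}-\mathrm R_{jk}\mathrm R_{il})+\frac{2(\mathrm R^2-|\mathrm{Ric}|^2)}{(n-1)(n-2)^2}(g_{ik}g_{jl}-g_{il}g_{jk}). \end{align*} -/

import Mathlib

open scoped Manifold ContDiff Bundle

noncomputable section

namespace WeylFlow

/-- Coordinate space `ℝⁿ`. -/
abbrev Coord (n : ℕ) : Type := EuclideanSpace ℝ (Fin n)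

/-! ### Riemannian geometry in one coordinate system

Throughout, `G y i j` are the components `g_{ij}` of a Riemannian metric at the point with
coordinates `y`. -/

section Coordinates

variable {n : ℕ}

/-- The `i`-th coordinate vector `∂/∂x^i`. -/
def basisVec (i : Fin n) : Coord n := EuclideanSpace.single i 1

/-- The partial derivative `∂f/∂x^i` at `y`. -/
def partialDeriv (i : Fin n) (f : Coord n → ℝ) (y : Coord n) : ℝ :=
  fderiv ℝ f y (basisVec i)

/-- The inverse metric `g^{ij}`. -/
def invMetric (G : Coord n → Matrix (Fin n) (Fin n) ℝ) (y : Coord n) :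
    Matrix (Fin n) (Fin n) ℝ := (G y)⁻¹

/-- The Christoffel symbols
`Γ^k_{ij} = ½ g^{kl} (∂_i g_{jl} + ∂_j g_{il} - ∂_l g_{ij})` of the Levi-Civita connection. -/
def christoffel (G : Coord n → Matrix (Fin n) (Fin n) ℝ) (y : Coord n) (k i j : Fin n) : ℝ :=
  (1 / 2) * ∑ l, invMetric G y k l *
    (partialDeriv i (fun z => G z j l) y + partialDeriv j (fun z => G z i l) y
      - partialDeriv l (fun z => G z i j) y)

/-- The Levi-Civita covariant derivative `∇_X Z` of a vector field,
`(∇_X Z)^k = X^i ∂_i Z^k + Γ^k_{ij} X^i Z^j`. -/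
def nabla (G : Coord n → Matrix (Fin n) (Fin n) ℝ) (X Z : Coord n → Coord n) :
    Coord n → Coord n := fun y =>
  WithLp.toLp 2 fun k =>
    ∑ i, X y i * partialDeriv i (fun z => Z z k) y
      + ∑ i, ∑ j, christoffel G y k i j * X y i * Z y j

/-- The curvature operator
`Riem(X,Y)Z = ∇_Y ∇_X Z - ∇_X ∇_Y Z + ∇_{[X,Y]} Z`. -/
def riemOp (G : Coord n → Matrix (Fin n) (Fin n) ℝ) (X Y Z : Coord n → Coord n) :
    Coord n → Coord n := fun y =>
  nabla G Y (nabla G X Z) y - nabla G X (nabla G Y Z) y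
    + nabla G (VectorField.lieBracket ℝ X Y) Z y

/-- The components `R_{ijkl} = g_{lm} R^m_{ijk}` of the Riemann tensor, where
`R^m_{ijk} ∂_m = Riem(∂_i, ∂_j) ∂_k`. -/
def riem (G : Coord n → Matrix (Fin n) (Fin n) ℝ) (y : Coord n) (i j k l : Fin n) : ℝ :=
  ∑ m, G y l m *
    riemOp G (fun _ => basisVec i) (fun _ => basisVec j) (fun _ => basisVec k) y m

/-- The Ricci tensor `R_{ik} = g^{jl} R_{ijkl}`. -/
def ricci (G : Coord n → Matrix (Fin n) (Fin n) ℝ) (y : Coord n) (i k : Fin n) : ℝ :=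
  ∑ j, ∑ l, invMetric G y j l * riem G y i j k l

/-- The scalar curvature `R = g^{ik} R_{ik}`. -/
def scalarCurv (G : Coord n → Matrix (Fin n) (Fin n) ℝ) (y : Coord n) : ℝ :=
  ∑ i, ∑ k, invMetric G y i k * ricci G y i k

/-- The squared norm `|Ric|² = g^{ip} g^{jq} R_{ij} R_{pq}`. -/
def ricciNormSq (G : Coord n → Matrix (Fin n) (Fin n) ℝ) (y : Coord n) : ℝ :=
  ∑ i, ∑ j, ∑ p, ∑ q,
    invMetric G y i p * invMetric G y j q * ricci G y i j * ricci G y p q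

/-- The components `W_{ijkl}` of the Weyl tensor (in dimension `n ≥ 3`). -/
def weyl (G : Coord n → Matrix (Fin n) (Fin n) ℝ) (y : Coord n) (i j k l : Fin n) : ℝ :=
  riem G y i j k l
    + scalarCurv G y / (((n : ℝ) - 1) * ((n : ℝ) - 2)) * (G y i k * G y j l - G y i l * G y j k)
    - 1 / ((n : ℝ) - 2) *
      (ricci G y i k * G y j l - ricci G y i l * G y j k
        + ricci G y j l * G y i k - ricci G y j k * G y i l)

/-- The covariant derivative of a covariant `r`-tensor, the new index coming first:
`(∇T)_{p i₁ … i_r} = ∇_p T_{i₁ … i_r} = ∂_p T_{i₁ … i_r} - ∑_a Γ^m_{p i_a} T_{i₁ … m … i_r}`,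
where `m` replaces `i_a`. -/
def covDeriv {r : ℕ} (G : Coord n → Matrix (Fin n) (Fin n) ℝ)
    (T : Coord n → (Fin r → Fin n) → ℝ) : Coord n → (Fin (r + 1) → Fin n) → ℝ := fun y I =>
  partialDeriv (I 0) (fun z => T z (Fin.tail I)) y
    - ∑ a : Fin r, ∑ m, christoffel G y m (I 0) (Fin.tail I a)
        * T y (Function.update (Fin.tail I) a m)

/-- The Laplacian `ΔT = g^{pq} ∇_p ∇_q T` of a covariant `r`-tensor. -/
def laplacian {r : ℕ} (G : Coord n → Matrix (Fin n) (Fin n) ℝ)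
    (T : Coord n → (Fin r → Fin n) → ℝ) (y : Coord n) (I : Fin r → Fin n) : ℝ :=
  ∑ p, ∑ q, invMetric G y p q * covDeriv G (covDeriv G T) y (Fin.cons p (Fin.cons q I))

/-- The component `ΔW_{ijkl}` of the Laplacian of the Weyl tensor. -/
def laplacianWeyl (G : Coord n → Matrix (Fin n) (Fin n) ℝ) (y : Coord n)
    (i j k l : Fin n) : ℝ :=
  laplacian G (fun z I => weyl G z (I 0) (I 1) (I 2) (I 3)) y ![i, j, k, l]

/-- `D_{ijkl} = g^{pq} g^{rs} W_{pijr} W_{slkq}`. -/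
def weylQuad (G : Coord n → Matrix (Fin n) (Fin n) ℝ) (y : Coord n) (i j k l : Fin n) : ℝ :=
  ∑ p, ∑ q, ∑ r, ∑ s,
    invMetric G y p q * invMetric G y r s * weyl G y p i j r * weyl G y s l k q

end Coordinates

/-! ### Ricci flow on a manifold -/

section Flow

variable {n : ℕ} {M : Type*} [TopologicalSpace M] [ChartedSpace (Coord n) M]
  [IsManifold (𝓡 n) ∞ M]

/-- Smooth Riemannian metrics on `M`. -/
abbrev RiemMetric (n : ℕ) (M : Type*) [TopologicalSpace M] [ChartedSpace (Coord n) M]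
    [IsManifold (𝓡 n) ∞ M] : Type _ :=
  Bundle.ContMDiffRiemannianMetric (IB := 𝓡 n) (n := ∞) (F := Coord n)
    (E := fun x : M => TangentSpace (𝓡 n) x)

/-- The coordinate vector field `∂/∂x^i` of the chart `φ`, as a tangent vector to `M` at the
point with coordinates `y`. -/
def coordField (φ : OpenPartialHomeomorph M (Coord n)) (y : Coord n) (i : Fin n) :
    TangentSpace (𝓡 n) (φ.symm y) :=
  mfderiv (𝓡 n) (𝓡 n) φ.symm y (basisVec i : Coord n)

/-- The components `g_{ij} = g(∂/∂x^i, ∂/∂x^j)` of a metric in the chart `φ`, as functions of the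
coordinates. -/
def coeff (g : RiemMetric n M) (φ : OpenPartialHomeomorph M (Coord n)) (y : Coord n) :
    Matrix (Fin n) (Fin n) ℝ :=
  Matrix.of fun i j => g.inner (φ.symm y) (coordField φ y i) (coordField φ y j)

/-- A family `g(t)`, `t ∈ I`, of Riemannian metrics on `M` is a (smooth) Ricci flow if in every
chart the components `g_{ij}` depend smoothly on time and space jointly and satisfy
`∂_t g_{ij} = -2 R_{ij}`. At an end point of `I` that belongs to `I` the time derivative is
one-sided. -/
structure IsRicciFlow (I : Set ℝ) (g : ℝ → RiemMetric n M) : Prop where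
  smooth : ∀ φ ∈ IsManifold.maximalAtlas (𝓡 n) ∞ M, ∀ i j : Fin n,
    ContDiffOn ℝ ∞ (fun q : ℝ × Coord n => coeff (g q.1) φ q.2 i j) (I ×ˢ φ.target)
  evolution : ∀ φ ∈ IsManifold.maximalAtlas (𝓡 n) ∞ M, ∀ t ∈ I, ∀ y ∈ φ.target, ∀ i j : Fin n,
    HasDerivWithinAt (fun s => coeff (g s) φ y i j) (-2 * ricci (coeff (g t) φ) y i j) I t

end Flow

end WeylFlow

end

/-!
The evolution equation is an identity in differential algebra. In a chart, the smooth functions of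
time and space on `I × U` form a commutative ring `MetricFamily.Fun` with commuting derivations
`∂_t, ∂_1, …, ∂_n`, over which the metric is an invertible symmetric matrix, and every object of the
statement is the value at a point of an element of this ring. (At an end point of `I` derivatives
are taken within `I × U`, which has unique differentials and lies in the closure of its interior,
so the derivations still commute.)

A direction of differentiation is a pair `Conn` of a derivation and a connection matrix. In space it
is `∂_p` with the Christoffel symbols; in time it is `∂_t` with the matrix `-Ric`, as in Uhlenbeck's
trick, and the Ricci flow equation says precisely that the metric is parallel in time as well. So
`∇_t` and `∇_p` both commute with traces and with products by the metric, and the second Bianchi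
identity `Conn.bianchi`, which is the Jacobi identity for three such operators, also holds with time
as one of the three directions. The mixed curvature `[∇_t, ∇_i]` is found from its symmetries
(`LeviCivita.IsFlow.metric_mul_curv`) to be `∇_l R_{ik} - ∇_k R_{il}`. Hence
`LeviCivita.IsFlow.cov4_rm` expresses `∇_t Rm` through second derivatives of `Ric`; the spatial
Bianchi identities give the same second derivatives for `Δ Rm` up to the commutators `[∇_p, ∇_i]`
(`LeviCivita.lap4_rm`). The difference is Hamilton's equation
`(∇_t - Δ) R_{ijkl} = 2 (B_{ijkl} - B_{ijlk} + B_{ikjl} - B_{iljk})`.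

The Weyl tensor is `Rm - S ∧ g`, where `S` is a combination of `Ric` and `R g`, so that
`(∇_t - Δ) W` is obtained from Hamilton's equation and its traces. It remains to insert
`Rm = W + S ∧ g` into the quadratic `B`, which is done pointwise in `weyl_reaction`: the terms linear
in `W` cancel. Passing from `∇_t W` back to `∂_t W` produces the terms `-g^{pq} R_{ip} W_{qjkl}` of
the statement.
-/

noncomputable section

namespace WeylFlow

open Matrix

/-! ### Connections over a differential ring -/

section DifferentialAlgebra

lemma sum_mul_sum_swap {ι A : Type*} [Fintype ι] [CommRing A] (u v : ι → A) (f : ι → ι → A) :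
    ∑ m, u m * ∑ p, v p * f m p = ∑ p, v p * ∑ m, u m * f m p := by
  simp only [Finset.mul_sum]
  rw [Finset.sum_comm]
  exact Finset.sum_congr rfl fun _ _ => Finset.sum_congr rfl fun _ _ => by ring

lemma sum_mul_sum_eq_mul {ι A : Type*} [Fintype ι] [CommRing A]
    (C E : Matrix ι ι A) (f : ι → A) (i : ι) :
    ∑ m, C m i * ∑ p, E p m * f p = ∑ p, (E * C) p i * f p := by
  simp only [Finset.mul_sum, Matrix.mul_apply, Finset.sum_mul]
  rw [Finset.sum_comm]
  exact Finset.sum_congr rfl fun _ _ => Finset.sum_congr rfl fun _ _ => by ring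

variable {ι A : Type*} [CommRing A] [Algebra ℝ A]

/-- Entrywise application of a derivation to a matrix. -/
def dMat (d : Derivation ℝ A A) (M : Matrix ι ι A) : Matrix ι ι A := M.map d

@[simp] lemma dMat_apply (d : Derivation ℝ A A) (M : Matrix ι ι A) (i j : ι) :
    dMat d M i j = d (M i j) := rfl

lemma dMat_add (d : Derivation ℝ A A) (M N : Matrix ι ι A) :
    dMat d (M + N) = dMat d M + dMat d N := by
  ext i j; simp

lemma dMat_sub (d : Derivation ℝ A A) (M N : Matrix ι ι A) :
    dMat d (M - N) = dMat d M - dMat d N := by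
  ext i j; simp

lemma dMat_neg (d : Derivation ℝ A A) (M : Matrix ι ι A) : dMat d (-M) = -dMat d M := by
  ext i j; simp

lemma dMat_transpose (d : Derivation ℝ A A) (M : Matrix ι ι A) : dMat d Mᵀ = (dMat d M)ᵀ := rfl

lemma dMat_comm {d e : Derivation ℝ A A} (h : ∀ a, d (e a) = e (d a)) (M : Matrix ι ι A) :
    dMat d (dMat e M) = dMat e (dMat d M) := by
  ext i j; simp [h]

lemma dMat_mul [Fintype ι] (d : Derivation ℝ A A) (M N : Matrix ι ι A) :
    dMat d (M * N) = dMat d M * N + M * dMat d N := by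
  ext i j
  simp only [dMat_apply, Matrix.mul_apply, Matrix.add_apply, map_sum, Derivation.leibniz,
    smul_eq_mul, Finset.sum_add_distrib]
  rw [add_comm]
  congr 1
  exact Finset.sum_congr rfl fun _ _ => mul_comm _ _

/-- A direction of differentiation for tensors: a derivation of the ring of functions, and the
matrix `form m i = Γ^m_i` of a connection on the tangent bundle in that direction. -/
structure Conn (ι A : Type*) [CommRing A] [Algebra ℝ A] where
  /-- The derivation of functions. -/
  der : Derivation ℝ A A
  /-- The connection matrix, upper index first. -/
  form : Matrix ι ι A

namespace Conn

/-- The derivations underlying `a` and `b` commute. -/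
def Comm (a b : Conn ι A) : Prop := ∀ x, a.der (b.der x) = b.der (a.der x)

lemma Comm.symm {a b : Conn ι A} (h : a.Comm b) : b.Comm a := fun x => (h x).symm

variable [Fintype ι]

/-- Covariant derivative of a covariant 2-tensor. -/
def cov2 (a : Conn ι A) (T : Matrix ι ι A) : Matrix ι ι A :=
  dMat a.der T - a.formᵀ * T - T * a.form

/-- Covariant derivative of a covariant 4-tensor. -/
def cov4 (a : Conn ι A) (T : ι → ι → ι → ι → A) (i j k l : ι) : A :=
  a.der (T i j k l) - ∑ m, a.form m i * T m j k l - ∑ m, a.form m j * T i m k l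
    - ∑ m, a.form m k * T i j m l - ∑ m, a.form m l * T i j k m

/-- The curvature `[∇_a, ∇_b]` as an endomorphism, upper index first. -/
def curv (a b : Conn ι A) : Matrix ι ι A :=
  dMat a.der b.form - dMat b.der a.form + a.form * b.form - b.form * a.form

/-- The metric `g` is parallel in the direction `a`. -/
def Compatible (a : Conn ι A) (g : Matrix ι ι A) : Prop :=
  dMat a.der g = a.formᵀ * g + g * a.form

variable {a b c : Conn ι A} {g ginv : Matrix ι ι A}

lemma curv_swap (a b : Conn ι A) : curv a b = -curv b a := by
  unfold curv; abel

lemma cov2_apply (a : Conn ι A) (T : Matrix ι ι A) (i k : ι) :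
    a.cov2 T i k = a.der (T i k) - ∑ m, a.form m i * T m k - ∑ m, T i m * a.form m k := by
  simp [cov2, Matrix.mul_apply]

lemma cov2_transpose (a : Conn ι A) (T : Matrix ι ι A) : a.cov2 Tᵀ = (a.cov2 T)ᵀ := by
  simp only [cov2, dMat_transpose, transpose_sub, transpose_mul, transpose_transpose]
  abel

lemma cov2_neg (a : Conn ι A) (T : Matrix ι ι A) : a.cov2 (-T) = -a.cov2 T := by
  simp only [cov2, dMat_neg, mul_neg, neg_mul]; abel

lemma cov2_sub (a : Conn ι A) (T U : Matrix ι ι A) : a.cov2 (T - U) = a.cov2 T - a.cov2 U := by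
  simp only [cov2, dMat_sub, mul_sub, sub_mul]; abel

lemma cov2_smul (a : Conn ι A) (r : ℝ) (T : Matrix ι ι A) :
    a.cov2 (r • T) = r • a.cov2 T := by
  have : dMat a.der (r • T) = r • dMat a.der T := by ext i j; simp
  simp only [cov2, this, Matrix.mul_smul, Matrix.smul_mul, smul_sub]

/-- A function times the metric is differentiated by differentiating the function. -/
lemma cov2_smul_metric (ha : a.Compatible g) (f : A) : a.cov2 (f • g) = a.der f • g := by
  have : dMat a.der (f • g) = f • dMat a.der g + a.der f • g := by
    ext i j; simp [mul_comm]
  rw [cov2, this, ha, Matrix.mul_smul, Matrix.smul_mul, smul_add]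
  abel

/-- The curvature with lowered index is antisymmetric, because the second derivatives of the
metric commute. -/
lemma metric_mul_curv_transpose (hg : gᵀ = g) (ha : a.Compatible g) (hb : b.Compatible g)
    (hab : a.Comm b) : (g * curv a b)ᵀ = -(g * curv a b) := by
  have h := dMat_comm hab g
  unfold Compatible at ha hb
  rw [hb, ha] at h
  simp only [dMat_add, dMat_mul, ha, hb, dMat_transpose] at h
  rw [transpose_mul, hg]
  have h' := sub_eq_zero.2 h
  rw [eq_neg_iff_add_eq_zero, ← h', curv]
  simp only [transpose_add, transpose_sub, transpose_mul]
  noncomm_ring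

/-- Second Bianchi identity: the Jacobi identity for the operators `∇_a, ∇_b, ∇_c`. -/
lemma bianchi (ha : a.Compatible g) (hb : b.Compatible g) (hc : c.Compatible g)
    (hab : a.Comm b) (hbc : b.Comm c) (hca : c.Comm a) :
    a.cov2 (g * curv b c) + b.cov2 (g * curv c a) + c.cov2 (g * curv a b) = 0 := by
  have key : ∀ {x : Conn ι A} (_ : x.Compatible g) (F : Matrix ι ι A),
      x.cov2 (g * F) = g * (dMat x.der F + x.form * F - F * x.form) := by
    intro x hx F
    unfold Compatible at hx
    rw [cov2, dMat_mul, hx]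
    noncomm_ring
  rw [key ha, key hb, key hc, ← mul_add, ← mul_add]
  have h1 := dMat_comm hab c.form
  have h2 := dMat_comm hbc a.form
  have h3 := dMat_comm hca b.form
  convert mul_zero g
  simp only [curv, dMat_add, dMat_sub, dMat_mul, h1, h2, h3]
  noncomm_ring

/-- The inverse of a parallel metric is parallel. -/
lemma Compatible.dMat_inv [DecidableEq ι] (ha : a.Compatible g) (h : g * ginv = 1) :
    dMat a.der ginv = -(ginv * a.formᵀ) - a.form * ginv := by
  have h2 : ginv * g = 1 := mul_eq_one_comm.1 h
  have h3 : dMat a.der (g * ginv) = 0 := by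
    rw [h]; ext i j
    by_cases hij : i = j <;> simp [hij]
  unfold Compatible at ha
  rw [dMat_mul, ha] at h3
  calc dMat a.der ginv = ginv * g * dMat a.der ginv := by rw [h2, one_mul]
    _ = ginv * ((a.formᵀ * g + g * a.form) * ginv + g * dMat a.der ginv)
        - ginv * a.formᵀ * (g * ginv) - (ginv * g) * a.form * ginv := by noncomm_ring
    _ = _ := by rw [h3, h, h2]; simp

end Conn

variable [Fintype ι]

/-! ### Traces and products with the metric -/

/-- Trace `X_{ik} = g^{jl} T_{ijkl}`. -/
def trace24 (ginv : Matrix ι ι A) (T : ι → ι → ι → ι → A) : Matrix ι ι A :=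
  Matrix.of fun i k => ∑ j, ∑ l, ginv j l * T i j k l

/-- Trace `g^{ik} T_{ik}`. -/
def trace2 (ginv T : Matrix ι ι A) : A := ∑ i, ∑ k, ginv i k * T i k

/-- The Kulkarni–Nomizu product of a symmetric 2-tensor with the metric. -/
def kn (g X : Matrix ι ι A) (i j k l : ι) : A :=
  X i k * g j l - X i l * g j k + X j l * g i k - X j k * g i l

namespace Conn

variable {a b : Conn ι A} {g ginv : Matrix ι ι A}

lemma cov4_sub (a : Conn ι A) (T U : ι → ι → ι → ι → A) (i j k l : ι) :
    a.cov4 (fun i j k l => T i j k l - U i j k l) i j k l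
      = a.cov4 T i j k l - a.cov4 U i j k l := by
  simp only [cov4, map_sub, mul_sub, Finset.sum_sub_distrib]; ring

lemma cov4_add (a : Conn ι A) (T U : ι → ι → ι → ι → A) (i j k l : ι) :
    a.cov4 (fun i j k l => T i j k l + U i j k l) i j k l
      = a.cov4 T i j k l + a.cov4 U i j k l := by
  simp only [cov4, map_add, mul_add, Finset.sum_add_distrib]; ring

lemma cov4_neg (a : Conn ι A) (T : ι → ι → ι → ι → A) (i j k l : ι) :
    a.cov4 (fun i j k l => -T i j k l) i j k l = -a.cov4 T i j k l := by
  simp only [cov4, map_neg, mul_neg, Finset.sum_neg_distrib]; ring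

lemma cov4_prod (ha : a.Compatible g) (X : Matrix ι ι A) (i j k l : ι) :
    a.cov4 (fun i j k l => X i k * g j l) i j k l = a.cov2 X i k * g j l := by
  have h : a.der (g j l) = ∑ m, a.form m j * g m l + ∑ m, g j m * a.form m l := by
    have := congrFun (congrFun ha j) l
    simpa [Matrix.mul_apply] using this
  simp only [cov4, cov2_apply, Derivation.leibniz, smul_eq_mul, h, sub_mul, Finset.sum_mul, mul_add,
    Finset.mul_sum]
  have e1 : ∀ m, a.form m i * (X m k * g j l) = a.form m i * X m k * g j l := fun m => by ring
  have e2 : ∀ m, a.form m j * (X i k * g m l) = X i k * (a.form m j * g m l) := fun m => by ring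
  have e3 : ∀ m, a.form m k * (X i m * g j l) = X i m * a.form m k * g j l := fun m => by ring
  have e4 : ∀ m, a.form m l * (X i k * g j m) = X i k * (g j m * a.form m l) := fun m => by ring
  simp only [e1, e2, e3, e4]
  ring

lemma cov4_perm_kl (a : Conn ι A) (T : ι → ι → ι → ι → A) (i j k l : ι) :
    a.cov4 (fun i j k l => T i j l k) i j k l = a.cov4 T i j l k := by
  simp only [cov4]; ring

lemma cov4_perm_ij (a : Conn ι A) (T : ι → ι → ι → ι → A) (i j k l : ι) :
    a.cov4 (fun i j k l => T j i k l) i j k l = a.cov4 T j i k l := by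
  simp only [cov4]; ring

lemma cov4_perm_pair (a : Conn ι A) (T : ι → ι → ι → ι → A) (i j k l : ι) :
    a.cov4 (fun i j k l => T k l i j) i j k l = a.cov4 T k l i j := by
  simp only [cov4]; ring

lemma cov4_kn (ha : a.Compatible g) (X : Matrix ι ι A) (i j k l : ι) :
    a.cov4 (kn g X) i j k l = kn g (a.cov2 X) i j k l := by
  have h1 := cov4_prod ha X
  have h2 : a.cov4 (fun i j k l => X i l * g j k) i j k l = _ :=
    (cov4_perm_kl a (fun i j k l => X i k * g j l) i j k l).trans (h1 i j l k)
  have h3 : a.cov4 (fun i j k l => X j k * g i l) i j k l = _ :=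
    (cov4_perm_ij a (fun i j k l => X i k * g j l) i j k l).trans (h1 j i k l)
  have h4 : a.cov4 (fun i j k l => X j l * g i k) i j k l = _ :=
    (cov4_perm_ij a (fun i j k l => X i l * g j k) i j k l).trans
      ((cov4_perm_kl a (fun i j k l => X i k * g j l) j i k l).trans (h1 j i l k))
  have h : a.cov4 (kn g X) i j k l = a.cov4 (fun i j k l => X i k * g j l) i j k l
      - a.cov4 (fun i j k l => X i l * g j k) i j k l
      + a.cov4 (fun i j k l => X j l * g i k) i j k l
      - a.cov4 (fun i j k l => X j k * g i l) i j k l := by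
    rw [← cov4_sub, ← cov4_add, ← cov4_sub]; rfl
  rw [h, h1, h2, h3, h4, kn]

lemma Compatible.der_inv [DecidableEq ι] (ha : a.Compatible g) (h : g * ginv = 1) (j l : ι) :
    a.der (ginv j l) = -∑ m, ginv j m * a.form l m - ∑ m, a.form j m * ginv m l := by
  have := congrFun (congrFun (ha.dMat_inv h) j) l
  simpa [Matrix.mul_apply] using this

lemma cov2_trace24 [DecidableEq ι] (ha : a.Compatible g) (h : g * ginv = 1)
    (T : ι → ι → ι → ι → A) : a.cov2 (trace24 ginv T) = trace24 ginv (a.cov4 T) := by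
  ext i k
  have e1 : ∑ j, ∑ l, (∑ m, ginv j m * a.form l m) * T i j k l
      = ∑ j, ∑ l, ginv j l * ∑ m, a.form m l * T i j k m := by
    refine Finset.sum_congr rfl fun j _ => ?_
    simp only [Finset.sum_mul, Finset.mul_sum]
    rw [Finset.sum_comm]
    exact Finset.sum_congr rfl fun _ _ => Finset.sum_congr rfl fun _ _ => by ring
  have e2 : ∑ j, ∑ l, (∑ m, a.form j m * ginv m l) * T i j k l
      = ∑ j, ∑ l, ginv j l * ∑ m, a.form m j * T i m k l := by
    simp only [Finset.sum_mul, Finset.mul_sum]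
    rw [Finset.sum_congr rfl fun j _ => Finset.sum_comm, Finset.sum_comm]
    refine Finset.sum_congr rfl fun j _ => ?_
    rw [Finset.sum_comm]
    exact Finset.sum_congr rfl fun _ _ => Finset.sum_congr rfl fun _ _ => by ring
  have e3 : ∑ m, a.form m i * ∑ j, ∑ l, ginv j l * T m j k l
      = ∑ j, ∑ l, ginv j l * ∑ m, a.form m i * T m j k l := by
    simp only [Finset.mul_sum]
    rw [Finset.sum_comm]
    refine Finset.sum_congr rfl fun j _ => ?_
    rw [Finset.sum_comm]
    exact Finset.sum_congr rfl fun _ _ => Finset.sum_congr rfl fun _ _ => by ring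
  have e4 : ∑ m, (∑ j, ∑ l, ginv j l * T i j m l) * a.form m k
      = ∑ j, ∑ l, ginv j l * ∑ m, a.form m k * T i j m l := by
    simp only [Finset.mul_sum, Finset.sum_mul]
    rw [Finset.sum_comm]
    refine Finset.sum_congr rfl fun j _ => ?_
    rw [Finset.sum_comm]
    exact Finset.sum_congr rfl fun _ _ => Finset.sum_congr rfl fun _ _ => by ring
  have e5 : ∀ j l, ginv j l * a.der (T i j k l) + T i j k l * a.der (ginv j l)
      = ginv j l * a.der (T i j k l) - (∑ m, ginv j m * a.form l m) * T i j k l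
        - (∑ m, a.form j m * ginv m l) * T i j k l := by
    intro j l; rw [ha.der_inv h]; ring
  simp only [cov2_apply, trace24, Matrix.of_apply, map_sum, Derivation.leibniz, smul_eq_mul, e3, e4,
    e5, cov4, mul_sub, Finset.sum_sub_distrib, e1, e2]
  ring

lemma der_trace2 [DecidableEq ι] (ha : a.Compatible g) (h : g * ginv = 1)
    (T : Matrix ι ι A) : a.der (trace2 ginv T) = trace2 ginv (a.cov2 T) := by
  have e1 : ∑ j, ∑ l, (∑ m, ginv j m * a.form l m) * T j l
      = ∑ j, ∑ l, ginv j l * ∑ m, T j m * a.form m l := by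
    refine Finset.sum_congr rfl fun j _ => ?_
    simp only [Finset.sum_mul, Finset.mul_sum]
    rw [Finset.sum_comm]
    exact Finset.sum_congr rfl fun _ _ => Finset.sum_congr rfl fun _ _ => by ring
  have e2 : ∑ j, ∑ l, (∑ m, a.form j m * ginv m l) * T j l
      = ∑ j, ∑ l, ginv j l * ∑ m, a.form m j * T m l := by
    simp only [Finset.sum_mul, Finset.mul_sum]
    rw [Finset.sum_congr rfl fun j _ => Finset.sum_comm, Finset.sum_comm]
    refine Finset.sum_congr rfl fun j _ => ?_
    rw [Finset.sum_comm]
    exact Finset.sum_congr rfl fun _ _ => Finset.sum_congr rfl fun _ _ => by ring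
  have e5 : ∀ j l, ginv j l * a.der (T j l) + T j l * a.der (ginv j l)
      = ginv j l * a.der (T j l) - (∑ m, ginv j m * a.form l m) * T j l
        - (∑ m, a.form j m * ginv m l) * T j l := by
    intro j l; rw [ha.der_inv h]; ring
  simp only [trace2, map_sum, Derivation.leibniz, smul_eq_mul,
    e5, cov2_apply, mul_sub, Finset.sum_sub_distrib, e1, e2]
  ring

/-! ### The Ricci identity -/

/-- Action of an endomorphism on a covariant 4-tensor by substitution in each slot. -/
def act4 (F : Matrix ι ι A) (T : ι → ι → ι → ι → A) (i j k l : ι) : A :=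
  ∑ m, F m i * T m j k l + ∑ m, F m j * T i m k l + ∑ m, F m k * T i j m l
    + ∑ m, F m l * T i j k m

/-- Ricci identity for covariant 4-tensors. -/
lemma cov4_cov4_sub (hab : a.Comm b) (T : ι → ι → ι → ι → A) (i j k l : ι) :
    a.cov4 (b.cov4 T) i j k l - b.cov4 (a.cov4 T) i j k l = -act4 (curv a b) T i j k l := by
  simp only [cov4, map_sub, map_sum, Derivation.leibniz, smul_eq_mul, mul_sub,
    Finset.sum_sub_distrib, Finset.sum_add_distrib, sum_mul_sum_eq_mul, act4, curv,
    Matrix.sub_apply, Matrix.add_apply, dMat_apply, sub_mul, add_mul, hab (T i j k l)]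
  rw [sum_mul_sum_swap (fun m => a.form m i) (fun m => b.form m j) fun m p => T m p k l,
    sum_mul_sum_swap (fun m => a.form m i) (fun m => b.form m k) fun m p => T m j p l,
    sum_mul_sum_swap (fun m => a.form m i) (fun m => b.form m l) fun m p => T m j k p,
    sum_mul_sum_swap (fun m => a.form m j) (fun m => b.form m i) fun m p => T p m k l,
    sum_mul_sum_swap (fun m => a.form m j) (fun m => b.form m k) fun m p => T i m p l,
    sum_mul_sum_swap (fun m => a.form m j) (fun m => b.form m l) fun m p => T i m k p,
    sum_mul_sum_swap (fun m => a.form m k) (fun m => b.form m i) fun m p => T p j m l,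
    sum_mul_sum_swap (fun m => a.form m k) (fun m => b.form m j) fun m p => T i p m l,
    sum_mul_sum_swap (fun m => a.form m k) (fun m => b.form m l) fun m p => T i j m p,
    sum_mul_sum_swap (fun m => a.form m l) (fun m => b.form m i) fun m p => T p j k m,
    sum_mul_sum_swap (fun m => a.form m l) (fun m => b.form m j) fun m p => T i p k m,
    sum_mul_sum_swap (fun m => a.form m l) (fun m => b.form m k) fun m p => T i j p m]
  simp only [mul_comm (T _ _ _ _)]
  ring

end Conn

end DifferentialAlgebra

/-! ### The Levi-Civita connection and the symmetries of its curvature -/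

/-- A metric on a ring of functions with commuting coordinate derivations, together with its
inverse and its Levi-Civita connection. -/
structure LeviCivita (ι A : Type*) [Fintype ι] [DecidableEq ι] [CommRing A] [Algebra ℝ A] where
  /-- The metric. -/
  g : Matrix ι ι A
  /-- The inverse metric. -/
  ginv : Matrix ι ι A
  /-- The coordinate directions: `∂_p` with the connection matrix `Γ^m_{pi}`. -/
  conn : ι → Conn ι A
  g_symm : gᵀ = g
  g_mul_ginv : g * ginv = 1
  comm : ∀ p q, (conn p).Comm (conn q)
  compat : ∀ p, (conn p).Compatible g
  torsion_free : ∀ p q m, (conn p).form m q = (conn q).form m p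

/-- The full contraction `g^{pq} g^{rs} X_{pr} Y_{qs}` of two 2-tensors. -/
def dot {ι A : Type*} [Fintype ι] [CommRing A] (ginv X Y : Matrix ι ι A) : A :=
  ∑ p, ∑ q, ∑ r, ∑ s, ginv p q * ginv r s * X p r * Y q s

/-- The matrix `(p, r) ↦ T_{pijr}`. -/
def inner23 {ι A : Type*} (T : ι → ι → ι → ι → A) (i j : ι) : Matrix ι ι A :=
  Matrix.of fun p r => T p i j r

/-- Hamilton's quadratic expression `2 (B_{ijkl} - B_{ijlk} + B_{ikjl} - B_{iljk})` in a tensor `T`,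
with `B_{ijkl} = g^{pq} g^{rs} T_{pijr} T_{qkls}`. -/
def hamiltonQuad {ι A : Type*} [Fintype ι] [CommRing A] (ginv : Matrix ι ι A)
    (T : ι → ι → ι → ι → A) (i j k l : ι) : A :=
  2 * (dot ginv (inner23 T i j) (inner23 T k l) - dot ginv (inner23 T i j) (inner23 T l k)
    + dot ginv (inner23 T i k) (inner23 T j l) - dot ginv (inner23 T i l) (inner23 T j k))

/-- Two pairs of summation indices may be interchanged. -/
lemma sum_pair_comm {ι A : Type*} [Fintype ι] [AddCommMonoid A] (Z : ι → ι → ι → ι → A) :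
    ∑ p, ∑ q, ∑ r, ∑ s, Z p q r s = ∑ r, ∑ s, ∑ p, ∑ q, Z p q r s := by
  simp only [← Fintype.sum_prod_type']
  exact Fintype.sum_equiv ⟨fun x => (x.2.2.1, x.2.2.2, x.1, x.2.1),
    fun x => (x.2.2.1, x.2.2.2, x.1, x.2.1), fun _ => rfl, fun _ => rfl⟩ _ _ fun _ => rfl

section Dot

variable {ι A : Type*} [Fintype ι] [CommRing A] {ginv : Matrix ι ι A}

lemma dot_add_left (X X' Y : Matrix ι ι A) :
    dot ginv (X + X') Y = dot ginv X Y + dot ginv X' Y := by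
  simp only [dot, Matrix.add_apply, mul_add, add_mul, Finset.sum_add_distrib]

lemma dot_add_right (X Y Y' : Matrix ι ι A) :
    dot ginv X (Y + Y') = dot ginv X Y + dot ginv X Y' := by
  simp only [dot, Matrix.add_apply, mul_add, Finset.sum_add_distrib]

lemma dot_sub_right (X Y Y' : Matrix ι ι A) :
    dot ginv X (Y - Y') = dot ginv X Y - dot ginv X Y' := by
  simp only [dot, Matrix.sub_apply, mul_sub, Finset.sum_sub_distrib]

lemma dot_neg_right (X Y : Matrix ι ι A) : dot ginv X (-Y) = -dot ginv X Y := by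
  simp only [dot, Matrix.neg_apply, mul_neg, Finset.sum_neg_distrib]

lemma dot_comm (h : ginvᵀ = ginv) (X Y : Matrix ι ι A) : dot ginv X Y = dot ginv Y X := by
  have hs : ∀ a b, ginv a b = ginv b a := fun a b => congrFun (congrFun h b) a
  unfold dot
  rw [Finset.sum_comm]
  refine Finset.sum_congr rfl fun p _ => Finset.sum_congr rfl fun q _ => ?_
  rw [Finset.sum_comm]
  refine Finset.sum_congr rfl fun r _ => Finset.sum_congr rfl fun s _ => ?_
  rw [hs q p, hs s r]; ring

lemma dot_transpose (X Y : Matrix ι ι A) : dot ginv Xᵀ Yᵀ = dot ginv X Y := by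
  unfold dot
  rw [sum_pair_comm]
  refine Finset.sum_congr rfl fun p _ => Finset.sum_congr rfl fun q _ => ?_
  refine Finset.sum_congr rfl fun r _ => Finset.sum_congr rfl fun s _ => ?_
  simp only [transpose_apply]; ring

end Dot

/-- The algebraic symmetries of a curvature tensor. -/
structure CurvatureLike {ι A : Type*} [CommRing A] (T : ι → ι → ι → ι → A) : Prop where
  swap12 : ∀ i j k l, T i j k l = -T j i k l
  swap34 : ∀ i j k l, T i j k l = -T i j l k
  pair : ∀ i j k l, T i j k l = T k l i j
  cyclic : ∀ i j k l, T i j k l + T j k i l + T k i j l = 0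

lemma CurvatureLike.inner23_swap {ι A : Type*} [CommRing A] {T : ι → ι → ι → ι → A}
    (hT : CurvatureLike T) (i j : ι) : inner23 T j i = (inner23 T i j)ᵀ := by
  ext p r
  simp only [inner23, Matrix.of_apply, transpose_apply]
  rw [hT.pair, hT.swap12, hT.swap34, neg_neg]

/-- The pair symmetry of a curvature tensor follows from the other symmetries. -/
lemma CurvatureLike.of_cyclic {ι A : Type*} [CommRing A] [Algebra ℝ A] {T : ι → ι → ι → ι → A}
    (h12 : ∀ i j k l, T i j k l = -T j i k l) (h34 : ∀ i j k l, T i j k l = -T i j l k)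
    (hc : ∀ i j k l, T i j k l + T j k i l + T k i j l = 0) : CurvatureLike T where
  swap12 := h12
  swap34 := h34
  cyclic := hc
  pair i j k l := by
    have h2 : (2 : ℝ) • T i j k l = (2 : ℝ) • T k l i j := by
      simp only [two_smul]
      linear_combination hc i j k l + hc j k l i - hc k l i j - hc l i j k - h34 j k i l
        - h34 k l j i + h34 i j k l - h12 k i j l + h34 i k j l - h12 l j k i + h34 j l k i
        + h34 l i k j
    have := congrArg (fun x => (2⁻¹ : ℝ) • x) h2
    simpa [smul_smul] using this

namespace LeviCivita

variable {ι A : Type*} [Fintype ι] [DecidableEq ι] [CommRing A] [Algebra ℝ A]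
  (L : LeviCivita ι A)

/-- The Riemann tensor `R_{ijkl} = g_{lm} R^m_{ijk}`, with `R_{ij} = [∇_j, ∇_i]`. -/
def rm (i j k l : ι) : A := (L.g * Conn.curv (L.conn j) (L.conn i)) l k

/-- The Ricci tensor `R_{ik} = g^{jl} R_{ijkl}`. -/
def ric : Matrix ι ι A := trace24 L.ginv L.rm

/-- The scalar curvature. -/
def scal : A := trace2 L.ginv L.ric

lemma ginv_mul_g : L.ginv * L.g = 1 := mul_eq_one_comm.1 L.g_mul_ginv

lemma ginv_symm : L.ginvᵀ = L.ginv := by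
  have h := congrArg transpose L.g_mul_ginv
  rw [transpose_mul, L.g_symm, transpose_one] at h
  calc L.ginvᵀ = L.ginvᵀ * (L.g * L.ginv) := by rw [L.g_mul_ginv, mul_one]
    _ = L.ginv := by rw [← mul_assoc, h, one_mul]

lemma ginv_swap (p q : ι) : L.ginv p q = L.ginv q p := congrFun (congrFun L.ginv_symm q) p

lemma rm_swap12 (i j k l : ι) : L.rm i j k l = -L.rm j i k l := by
  rw [rm, Conn.curv_swap, mul_neg, Matrix.neg_apply, rm]

lemma rm_swap34 (i j k l : ι) : L.rm i j k l = -L.rm i j l k := by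
  have := congrFun (congrFun (Conn.metric_mul_curv_transpose L.g_symm (L.compat j) (L.compat i)
    (L.comm j i)) k) l
  simpa [rm] using this

lemma rm_cyclic (i j k l : ι) : L.rm i j k l + L.rm j k i l + L.rm k i j l = 0 := by
  simp only [rm, Matrix.mul_apply, ← Finset.sum_add_distrib, ← mul_add]
  refine Finset.sum_eq_zero fun m _ => ?_
  simp only [Conn.curv, Matrix.sub_apply, Matrix.add_apply, dMat_apply, Matrix.mul_apply,
    L.torsion_free j i, L.torsion_free k i, L.torsion_free k j]
  ring

lemma curvatureLike_rm : CurvatureLike L.rm :=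
  .of_cyclic L.rm_swap12 L.rm_swap34 L.rm_cyclic

lemma ric_symm : L.ricᵀ = L.ric := by
  ext i k
  simp only [ric, trace24, transpose_apply, Matrix.of_apply]
  rw [Finset.sum_comm]
  refine Finset.sum_congr rfl fun j _ => Finset.sum_congr rfl fun l _ => ?_
  rw [L.ginv_swap, L.curvatureLike_rm.pair]

/-! ### Second covariant derivatives -/

/-- `∇_p ∇_q T` for a covariant 4-tensor. -/
def hess4 (p q : ι) (T : ι → ι → ι → ι → A) (i j k l : ι) : A :=
  (L.conn p).cov4 ((L.conn q).cov4 T) i j k l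
    - ∑ m, (L.conn p).form m q * (L.conn m).cov4 T i j k l

/-- `∇_p ∇_q X` for a covariant 2-tensor. -/
def hess2 (p q : ι) (X : Matrix ι ι A) : Matrix ι ι A :=
  (L.conn p).cov2 ((L.conn q).cov2 X) - ∑ m, (L.conn p).form m q • (L.conn m).cov2 X

/-- `∇_p ∇_q f` for a function. -/
def hess0 (p q : ι) (f : A) : A :=
  (L.conn p).der ((L.conn q).der f) - ∑ m, (L.conn p).form m q * (L.conn m).der f

/-- The Laplacian `g^{pq} ∇_p ∇_q T` of a covariant 4-tensor. -/
def lap4 (T : ι → ι → ι → ι → A) (i j k l : ι) : A :=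
  ∑ p, ∑ q, L.ginv p q * L.hess4 p q T i j k l

/-- The Laplacian of a covariant 2-tensor. -/
def lap2 (X : Matrix ι ι A) : Matrix ι ι A := ∑ p, ∑ q, L.ginv p q • L.hess2 p q X

/-- The Laplacian of a function. -/
def lap0 (f : A) : A := ∑ p, ∑ q, L.ginv p q * L.hess0 p q f

lemma hess2_apply (p q : ι) (X : Matrix ι ι A) (i k : ι) :
    L.hess2 p q X i k = (L.conn p).cov2 ((L.conn q).cov2 X) i k
      - ∑ m, (L.conn p).form m q * (L.conn m).cov2 X i k := by
  simp [hess2, Matrix.sum_apply]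

lemma lap2_apply (X : Matrix ι ι A) (i k : ι) :
    L.lap2 X i k = ∑ p, ∑ q, L.ginv p q * L.hess2 p q X i k := by
  simp [lap2, Matrix.sum_apply]

lemma hess4_sub_hess4_swap (p q : ι) (T : ι → ι → ι → ι → A) (i j k l : ι) :
    L.hess4 p q T i j k l - L.hess4 q p T i j k l
      = -Conn.act4 (Conn.curv (L.conn p) (L.conn q)) T i j k l := by
  rw [← Conn.cov4_cov4_sub (L.comm p q)]
  simp only [hess4, L.torsion_free p q]
  ring

lemma hess4_swap12 {T : ι → ι → ι → ι → A} (hT : ∀ i j k l, T i j k l = -T j i k l)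
    (p q i j k l : ι) : L.hess4 p q T i j k l = -L.hess4 p q T j i k l := by
  have key : ∀ (a : Conn ι A) {U : ι → ι → ι → ι → A}, (∀ i j k l, U i j k l = -U j i k l) →
      ∀ i j k l, a.cov4 U i j k l = -a.cov4 U j i k l := by
    intro a U hU i j k l
    conv_lhs => rw [show U = fun i j k l => -(fun i j k l => U j i k l) i j k l from by
      funext i j k l; exact hU i j k l]
    rw [Conn.cov4_neg, Conn.cov4_perm_ij]
  simp only [hess4]
  rw [key _ (key _ hT), Finset.sum_congr rfl fun m _ => by rw [key _ hT]]
  simp only [mul_neg, Finset.sum_neg_distrib]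
  ring

lemma hess4_swap34 {T : ι → ι → ι → ι → A} (hT : ∀ i j k l, T i j k l = -T i j l k)
    (p q i j k l : ι) : L.hess4 p q T i j k l = -L.hess4 p q T i j l k := by
  have key : ∀ (a : Conn ι A) {U : ι → ι → ι → ι → A}, (∀ i j k l, U i j k l = -U i j l k) →
      ∀ i j k l, a.cov4 U i j k l = -a.cov4 U i j l k := by
    intro a U hU i j k l
    conv_lhs => rw [show U = fun i j k l => -(fun i j k l => U i j l k) i j k l from by
      funext i j k l; exact hU i j k l]
    rw [Conn.cov4_neg, Conn.cov4_perm_kl]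
  simp only [hess4]
  rw [key _ (key _ hT), Finset.sum_congr rfl fun m _ => by rw [key _ hT]]
  simp only [mul_neg, Finset.sum_neg_distrib]
  ring

lemma hess4_pair {T : ι → ι → ι → ι → A} (hT : ∀ i j k l, T i j k l = T k l i j)
    (p q i j k l : ι) : L.hess4 p q T i j k l = L.hess4 p q T k l i j := by
  have key : ∀ (a : Conn ι A) {U : ι → ι → ι → ι → A}, (∀ i j k l, U i j k l = U k l i j) →
      ∀ i j k l, a.cov4 U i j k l = a.cov4 U k l i j := by
    intro a U hU i j k l
    conv_lhs => rw [show U = fun i j k l => U k l i j from by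
      funext i j k l; exact hU i j k l]
    rw [Conn.cov4_perm_pair]
  simp only [hess4]
  rw [key _ (key _ hT), Finset.sum_congr rfl fun m _ => by rw [key _ hT]]

lemma sum_smul_trace24 (c : ι → A) (T : ι → ι → ι → ι → ι → A) :
    ∑ m, c m • trace24 L.ginv (T m)
      = trace24 L.ginv (fun i j k l => ∑ m, c m * T m i j k l) := by
  ext i k
  simp only [Matrix.sum_apply, Matrix.smul_apply, trace24, Matrix.of_apply, smul_eq_mul,
    Finset.mul_sum]
  rw [Finset.sum_comm]
  refine Finset.sum_congr rfl fun j _ => ?_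
  rw [Finset.sum_comm]
  exact Finset.sum_congr rfl fun _ _ => Finset.sum_congr rfl fun _ _ => by ring

lemma trace24_sub (T U : ι → ι → ι → ι → A) :
    trace24 L.ginv (fun i j k l => T i j k l - U i j k l)
      = trace24 L.ginv T - trace24 L.ginv U := by
  ext i k
  simp only [trace24, Matrix.of_apply, Matrix.sub_apply, mul_sub, Finset.sum_sub_distrib]

lemma hess2_trace24 (p q : ι) (T : ι → ι → ι → ι → A) :
    L.hess2 p q (trace24 L.ginv T) = trace24 L.ginv (L.hess4 p q T) := by
  have h := fun a => Conn.cov2_trace24 (L.compat a) L.g_mul_ginv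
  simp only [hess2, h, sum_smul_trace24, ← trace24_sub]
  rfl

lemma lap2_trace24 (T : ι → ι → ι → ι → A) :
    L.lap2 (trace24 L.ginv T) = trace24 L.ginv (L.lap4 T) := by
  ext i k
  simp only [lap2_apply, hess2_trace24]
  simp only [trace24, Matrix.of_apply, lap4, Finset.mul_sum]
  rw [sum_pair_comm]
  simp only [mul_left_comm]

lemma hess0_trace2 (p q : ι) (X : Matrix ι ι A) :
    L.hess0 p q (trace2 L.ginv X) = trace2 L.ginv (L.hess2 p q X) := by
  have h := fun a => Conn.der_trace2 (L.compat a) L.g_mul_ginv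
  simp only [hess0, h]
  simp only [trace2, hess2_apply, mul_sub, Finset.sum_sub_distrib, Finset.mul_sum]
  congr 1
  rw [Finset.sum_comm]
  refine Finset.sum_congr rfl fun j _ => ?_
  rw [Finset.sum_comm]
  exact Finset.sum_congr rfl fun _ _ => Finset.sum_congr rfl fun _ _ => by ring

lemma lap0_trace2 (X : Matrix ι ι A) :
    L.lap0 (trace2 L.ginv X) = trace2 L.ginv (L.lap2 X) := by
  simp only [lap0, hess0_trace2]
  simp only [trace2, lap2_apply, Finset.mul_sum]
  rw [sum_pair_comm]
  simp only [mul_left_comm]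

end LeviCivita

namespace LeviCivita

variable {ι A : Type*} [Fintype ι] [DecidableEq ι] [CommRing A] [Algebra ℝ A]
  (L : LeviCivita ι A)

/-! ### The Laplacian of the Riemann tensor -/

/-- Second Bianchi identity for the Riemann tensor. -/
lemma cov4_rm_cyclic (p i j k l : ι) :
    (L.conn p).cov4 L.rm i j k l + (L.conn i).cov4 L.rm j p k l + (L.conn j).cov4 L.rm p i k l
      = 0 := by
  have e : ∀ p i j, (L.conn p).cov4 L.rm i j k l
      = (L.conn p).cov2 (L.g * Conn.curv (L.conn j) (L.conn i)) l k
        - ∑ m, (L.conn p).form m i * L.rm m j k l - ∑ m, (L.conn p).form m j * L.rm i m k l := by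
    intro p i j
    simp only [Conn.cov4, Conn.cov2_apply, rm, mul_comm _ ((L.conn p).form _ k)]
    ring
  have hb := congrFun (congrFun (Conn.bianchi (L.compat p) (L.compat j) (L.compat i)
    (L.comm p j) (L.comm j i) (L.comm i p)) l) k
  simp only [Matrix.add_apply, Matrix.zero_apply] at hb
  have hs : ∀ p i j, ∑ m, (L.conn p).form m i * L.rm j m k l
      = -∑ m, (L.conn i).form m p * L.rm m j k l := by
    intro p i j
    rw [← Finset.sum_neg_distrib]
    refine Finset.sum_congr rfl fun m _ => ?_
    rw [L.rm_swap12 j m, L.torsion_free p i]; ring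
  rw [e, e, e, hs p j i, hs i p j, hs j i p]
  linear_combination hb

/-- The derivative of the second Bianchi identity. -/
lemma hess4_rm_cyclic (r p i j k l : ι) :
    L.hess4 r p L.rm i j k l + L.hess4 r i L.rm j p k l + L.hess4 r j L.rm p i k l = 0 := by
  have h0 : (L.conn r).der ((L.conn p).cov4 L.rm i j k l + (L.conn i).cov4 L.rm j p k l
      + (L.conn j).cov4 L.rm p i k l) = 0 := by rw [cov4_rm_cyclic, map_zero]
  have hz : ∀ (c : ι → A) (f₁ f₂ f₃ : ι → A), (∀ m, f₁ m + f₂ m + f₃ m = 0) →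
      ∑ m, c m * f₁ m + ∑ m, c m * f₂ m + ∑ m, c m * f₃ m = 0 := by
    intro c f₁ f₂ f₃ h
    rw [← Finset.sum_add_distrib, ← Finset.sum_add_distrib]
    refine Finset.sum_eq_zero fun m _ => ?_
    rw [← mul_add, ← mul_add, h, mul_zero]
  have hp := hz (fun m => (L.conn r).form m p) _ _ _ fun m => L.cov4_rm_cyclic m i j k l
  have hi := hz (fun m => (L.conn r).form m i) _ _ _ fun m => L.cov4_rm_cyclic p m j k l
  have hj := hz (fun m => (L.conn r).form m j) _ _ _ fun m => L.cov4_rm_cyclic p i m k l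
  have hk := hz (fun m => (L.conn r).form m k) _ _ _ fun m => L.cov4_rm_cyclic p i j m l
  have hl := hz (fun m => (L.conn r).form m l) _ _ _ fun m => L.cov4_rm_cyclic p i j k m
  simp only [map_add] at h0
  simp only [hess4]
  have e : ∀ (U : ι → ι → ι → ι → A) i j k l, (L.conn r).cov4 U i j k l
      = (L.conn r).der (U i j k l) - ∑ m, (L.conn r).form m i * U m j k l
        - ∑ m, (L.conn r).form m j * U i m k l - ∑ m, (L.conn r).form m k * U i j m l
        - ∑ m, (L.conn r).form m l * U i j k m := fun _ _ _ _ _ => rfl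
  rw [e ((L.conn p).cov4 L.rm), e ((L.conn i).cov4 L.rm), e ((L.conn j).cov4 L.rm)]
  linear_combination h0 - hp - hi - hj - hk - hl

/-- The contracted second Bianchi identity, differentiated once. -/
lemma sum_ginv_hess4_rm (i j k l : ι) :
    ∑ p, ∑ q, L.ginv p q * L.hess4 i p L.rm q j k l
      = L.hess2 i k L.ric l j - L.hess2 i l L.ric k j := by
  have hR := L.curvatureLike_rm
  have h : ∀ p q, L.hess4 i p L.rm q j k l
      = L.hess4 i k L.rm l p j q - L.hess4 i l L.rm k p j q := by
    intro p q
    rw [L.hess4_pair hR.pair, L.hess4_swap34 hR.swap34 i k l p j q,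
      L.hess4_swap34 hR.swap34 i l k p j q, L.hess4_swap12 hR.swap12 i l k p]
    linear_combination L.hess4_rm_cyclic i p k l q j
  simp only [h, mul_sub, Finset.sum_sub_distrib, ric, hess2_trace24]
  rfl

lemma lap4_rm (i j k l : ι) :
    L.lap4 L.rm i j k l = L.hess2 i k L.ric l j - L.hess2 i l L.ric k j
      - L.hess2 j k L.ric l i + L.hess2 j l L.ric k i
      - ∑ p, ∑ q, L.ginv p q * (Conn.act4 (Conn.curv (L.conn p) (L.conn i)) L.rm q j k l
          - Conn.act4 (Conn.curv (L.conn p) (L.conn j)) L.rm q i k l) := by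
  have hR := L.curvatureLike_rm
  have h : ∀ p q, L.ginv p q * L.hess4 p q L.rm i j k l
      = L.ginv p q * L.hess4 i p L.rm q j k l - L.ginv p q * L.hess4 j p L.rm q i k l
      - L.ginv p q * (Conn.act4 (Conn.curv (L.conn p) (L.conn i)) L.rm q j k l
          - Conn.act4 (Conn.curv (L.conn p) (L.conn j)) L.rm q i k l) := by
    intro p q
    have h1 := L.hess4_sub_hess4_swap p i L.rm q j k l
    have h2 := L.hess4_sub_hess4_swap p j L.rm q i k l
    have h3 := L.hess4_rm_cyclic p q i j k l
    have h4 := L.hess4_swap12 hR.swap12 p i j q k l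
    linear_combination L.ginv p q * (h3 - h4 + h1 - h2)
  simp only [lap4, h]
  simp only [Finset.sum_sub_distrib, sum_ginv_hess4_rm]
  ring

/-- The quadratic curvature terms produced by commuting derivatives. -/
lemma sum_ginv_act4 (i j k l : ι) :
    ∑ p, ∑ q, L.ginv p q * Conn.act4 (Conn.curv (L.conn p) (L.conn i)) L.rm q j k l
      = -∑ m, (L.ginv * L.ric) m i * L.rm m j k l
        + dot L.ginv (inner23 L.rm i j) (inner23 L.rm k l)
        - dot L.ginv (inner23 L.rm i j) (inner23 L.rm l k)
        + dot L.ginv (inner23 L.rm i k) (inner23 L.rm j l)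
        - dot L.ginv (inner23 L.rm i l) (inner23 L.rm j k) := by
  have hR := L.curvatureLike_rm
  have hF : ∀ p m x, Conn.curv (L.conn p) (L.conn i) m x = ∑ s, L.ginv m s * L.rm i p x s := by
    intro p m x
    have : Conn.curv (L.conn p) (L.conn i)
        = L.ginv * (L.g * Conn.curv (L.conn p) (L.conn i)) := by
      rw [← mul_assoc, L.ginv_mul_g, one_mul]
    rw [this, Matrix.mul_apply]; rfl
  have hD : ∀ (x : ι) (Y : Matrix ι ι A),
      ∑ p, ∑ q, L.ginv p q * ∑ m, Conn.curv (L.conn p) (L.conn i) m x * Y q m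
        = -dot L.ginv (inner23 L.rm i x) Y := by
    intro x Y
    simp only [dot, ← Finset.sum_neg_distrib]
    refine Finset.sum_congr rfl fun p _ => Finset.sum_congr rfl fun q _ => ?_
    rw [Finset.mul_sum, Finset.sum_comm]
    refine Finset.sum_congr rfl fun m _ => ?_
    rw [hF, Finset.sum_mul, Finset.mul_sum]
    refine Finset.sum_congr rfl fun s _ => ?_
    rw [inner23, Matrix.of_apply, hR.swap12 i p, L.ginv_swap m s]; ring
  have h1 : ∑ p, ∑ q, L.ginv p q * ∑ m, Conn.curv (L.conn p) (L.conn i) m q * L.rm m j k l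
      = -∑ m, (L.ginv * L.ric) m i * L.rm m j k l := by
    have : ∀ m, (L.ginv * L.ric) m i
        = -∑ p, ∑ q, L.ginv p q * Conn.curv (L.conn p) (L.conn i) m q := by
      intro m
      have hs : ∀ s, L.ric s i = ∑ p, ∑ q, L.ginv p q * L.rm i p s q :=
        fun s => congrFun (congrFun L.ric_symm i) s
      simp only [Matrix.mul_apply, hF, hs, Finset.mul_sum, ← Finset.sum_neg_distrib]
      rw [Finset.sum_comm]
      refine Finset.sum_congr rfl fun p _ => ?_
      rw [Finset.sum_comm]
      refine Finset.sum_congr rfl fun q _ => Finset.sum_congr rfl fun s _ => ?_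
      rw [hR.swap34 i p q s]; ring
    simp only [this, neg_mul, Finset.sum_neg_distrib, neg_neg, Finset.sum_mul, Finset.mul_sum]
    rw [Finset.sum_congr rfl fun p _ => Finset.sum_comm, Finset.sum_comm]
    simp only [mul_assoc]
  have h2 : (Matrix.of fun q m => L.rm q m k l) = inner23 L.rm l k - inner23 L.rm k l := by
    ext q m
    simp only [inner23, Matrix.of_apply, Matrix.sub_apply]
    rw [hR.pair q l k m, hR.swap12 k m q l, hR.swap12 q k l m, hR.swap34 k q l m]
    linear_combination hR.cyclic q m k l
  have h3 : (Matrix.of fun q m => L.rm q j m l) = -inner23 L.rm j l := by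
    ext q m
    simp only [inner23, Matrix.of_apply, Matrix.neg_apply]
    exact hR.swap34 _ _ _ _
  have e2 := hD j (Matrix.of fun q m => L.rm q m k l)
  have e3 := hD k (Matrix.of fun q m => L.rm q j m l)
  have e4 := hD l (inner23 L.rm j k)
  rw [h2, dot_sub_right] at e2
  rw [h3, dot_neg_right] at e3
  have a2 : ∀ q m, (inner23 L.rm l k - inner23 L.rm k l) q m = L.rm q m k l := fun q m => by
    rw [← h2]; rfl
  have a3 : ∀ q m, (-inner23 L.rm j l) q m = L.rm q j m l := fun q m => by rw [← h3]; rfl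
  have a4 : ∀ q m, inner23 L.rm j k q m = L.rm q j k m := fun _ _ => rfl
  simp only [a2] at e2
  simp only [a3] at e3
  simp only [a4] at e4
  simp only [Conn.act4, mul_add, Finset.sum_add_distrib, h1, e2, e3, e4]
  ring

/-! ### Evolution of the curvature -/

/-- `t` is the time direction of a Ricci flow `∂_t g = -2 Ric`. The connection in the time direction
is `∇_t ∂_i = ∂_t ∂_i - Ric(∂_i)`, which makes the evolving metric parallel. -/
structure IsFlow (t : Conn ι A) : Prop where
  form_eq : t.form = -(L.ginv * L.ric)
  compat : t.Compatible L.g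
  comm : ∀ p, t.Comm (L.conn p)

variable {L} {t : Conn ι A}

/-- Mixed curvature of the space-time connection. It is antisymmetric in `l, k`, and since
`∂_t Γ^m_{ik}` is symmetric in `i, k` its antisymmetrization in `i, k` is that of `∇ Ric`; this
determines it, as in the Koszul formula. -/
lemma IsFlow.metric_mul_curv (ht : L.IsFlow t) (i l k : ι) :
    (L.g * Conn.curv t (L.conn i)) l k
      = (L.conn l).cov2 L.ric i k - (L.conn k).cov2 L.ric i l := by
  have hsymm : ∀ p a b, (L.conn p).cov2 L.ric a b = (L.conn p).cov2 L.ric b a := by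
    intro p a b
    have := Conn.cov2_transpose (L.conn p) L.ric
    rw [L.ric_symm] at this
    exact congrFun (congrFun this a) b
  have hmat : ∀ i, L.g * Conn.curv t (L.conn i)
      = L.g * dMat t.der (L.conn i).form + (L.conn i).cov2 L.ric := by
    intro i
    have hinv := (L.compat i).dMat_inv L.g_mul_ginv
    have : Conn.curv t (L.conn i) = dMat t.der (L.conn i).form
        + L.ginv * (L.conn i).cov2 L.ric := by
      rw [Conn.curv, ht.form_eq, dMat_neg, dMat_mul, hinv, Conn.cov2]
      noncomm_ring
    rw [this, mul_add, ← mul_assoc, L.g_mul_ginv, one_mul]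
  have hswap : ∀ i l k, (L.g * Conn.curv t (L.conn i)) l k
      - (L.g * Conn.curv t (L.conn k)) l i
      = (L.conn i).cov2 L.ric l k - (L.conn k).cov2 L.ric l i := by
    intro i l k
    rw [hmat, hmat, Matrix.add_apply, Matrix.add_apply, Matrix.mul_apply, Matrix.mul_apply]
    simp only [dMat_apply, L.torsion_free k i]
    ring
  have hanti : ∀ i l k, (L.g * Conn.curv t (L.conn i)) k l
      = -(L.g * Conn.curv t (L.conn i)) l k := by
    intro i l k
    exact congrFun (congrFun (Conn.metric_mul_curv_transpose L.g_symm ht.compat (L.compat i)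
      (ht.comm i)) l) k
  -- As in the Koszul formula: the three cyclic instances of `hswap`, with signs.
  have h2 : (2 : ℝ) • (L.g * Conn.curv t (L.conn i)) l k
      = (2 : ℝ) • ((L.conn l).cov2 L.ric i k - (L.conn k).cov2 L.ric i l) := by
    simp only [two_smul]
    linear_combination hswap i l k + hswap l k i - hswap k i l + hanti i l k
      + hanti k l i - hanti l i k + hsymm i l k + hsymm l k i - hsymm k l i
  have := congrArg (fun x => (2⁻¹ : ℝ) • x) h2
  simpa [smul_smul] using this

/-- Evolution of the Riemann tensor in terms of second derivatives of the Ricci tensor. -/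
lemma IsFlow.cov4_rm (ht : L.IsFlow t) (i j k l : ι) :
    t.cov4 L.rm i j k l = L.hess2 j l L.ric i k - L.hess2 j k L.ric i l - L.hess2 i l L.ric j k
      + L.hess2 i k L.ric j l + ∑ m, (L.ginv * L.ric) m i * L.rm m j k l
      + ∑ m, (L.ginv * L.ric) m j * L.rm i m k l := by
  have h0 : t.cov4 L.rm i j k l
      = t.cov2 (L.g * Conn.curv (L.conn j) (L.conn i)) l k
        + ∑ m, (L.ginv * L.ric) m i * L.rm m j k l + ∑ m, (L.ginv * L.ric) m j * L.rm i m k l := by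
    simp only [Conn.cov4, Conn.cov2_apply, rm, ht.form_eq, Matrix.neg_apply, neg_mul, mul_neg,
      Finset.sum_neg_distrib, mul_comm _ ((L.ginv * L.ric) _ k)]
    ring
  have hb := Conn.bianchi ht.compat (L.compat j) (L.compat i) (ht.comm j) (L.comm j i)
    (ht.comm i).symm
  rw [Conn.curv_swap (L.conn i) t, mul_neg, Conn.cov2_neg] at hb
  replace hb := congrFun (congrFun hb l) k
  simp only [Matrix.add_apply, Matrix.zero_apply, Matrix.neg_apply] at hb
  have hV : ∀ i j, (L.conn j).cov2 (L.g * Conn.curv t (L.conn i)) l k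
      = L.hess2 j l L.ric i k - L.hess2 j k L.ric i l
        + ∑ m, (L.conn j).form m i * ((L.conn l).cov2 L.ric m k - (L.conn k).cov2 L.ric m l) := by
    intro i j
    simp only [Conn.cov2_apply _ (L.g * _), ht.metric_mul_curv, hess2_apply,
      Conn.cov2_apply _ (Conn.cov2 _ _), mul_sub, Finset.sum_sub_distrib, map_sub,
      mul_comm _ ((L.conn j).form _ _)]
    ring
  rw [hV, hV] at hb
  simp only [L.torsion_free i j] at hb
  rw [h0]
  linear_combination hb

/-- Hamilton's evolution equation `(∇_t - Δ) Rm = 2 (B_{ijkl} - B_{ijlk} + B_{ikjl} - B_{iljk})`. -/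
lemma IsFlow.cov4_rm_sub_lap4 (ht : L.IsFlow t) (i j k l : ι) :
    t.cov4 L.rm i j k l - L.lap4 L.rm i j k l = hamiltonQuad L.ginv L.rm i j k l := by
  have hs : ∀ p q a b, L.hess2 p q L.ric a b = L.hess2 p q L.ric b a := by
    intro p q a b
    have h := fun (a : Conn ι A) X => Conn.cov2_transpose a X
    have : (L.hess2 p q L.ric)ᵀ = L.hess2 p q L.ric := by
      simp only [hess2, transpose_sub, transpose_sum, transpose_smul, ← h, L.ric_symm]
    exact congrFun (congrFun this b) a
  have hR := L.curvatureLike_rm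
  have hB : ∀ i j k l, dot L.ginv (inner23 L.rm j i) (inner23 L.rm k l)
      = dot L.ginv (inner23 L.rm i j) (inner23 L.rm l k) := by
    intro i j k l
    rw [hR.inner23_swap, hR.inner23_swap l k, dot_transpose]
  have hj : ∑ m, (L.ginv * L.ric) m j * L.rm i m k l
      = -∑ m, (L.ginv * L.ric) m j * L.rm m i k l := by
    rw [← Finset.sum_neg_distrib]
    exact Finset.sum_congr rfl fun m _ => by rw [L.rm_swap12 i m]; ring
  rw [ht.cov4_rm, lap4_rm]
  simp only [mul_sub, Finset.sum_sub_distrib, sum_ginv_act4]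
  rw [hj, hs j l i k, hs j k i l, hs i l j k, hs i k j l, hB i j k l, hB i j l k,
    dot_comm L.ginv_symm (inner23 L.rm j k), dot_comm L.ginv_symm (inner23 L.rm j l), hamiltonQuad]
  ring

/-- Evolution of the Ricci tensor. -/
lemma IsFlow.cov2_ric_sub_lap2 (ht : L.IsFlow t) :
    t.cov2 L.ric - L.lap2 L.ric = trace24 L.ginv (hamiltonQuad L.ginv L.rm) := by
  rw [ric, Conn.cov2_trace24 ht.compat L.g_mul_ginv, lap2_trace24, ← trace24_sub]
  simp only [ht.cov4_rm_sub_lap4]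

/-- Evolution of the scalar curvature. -/
lemma IsFlow.der_scal_sub_lap0 (ht : L.IsFlow t) :
    t.der L.scal - L.lap0 L.scal
      = trace2 L.ginv (trace24 L.ginv (hamiltonQuad L.ginv L.rm)) := by
  rw [scal, Conn.der_trace2 ht.compat L.g_mul_ginv, lap0_trace2, ← ht.cov2_ric_sub_lap2]
  simp only [trace2, Matrix.sub_apply, mul_sub, Finset.sum_sub_distrib]

/-! ### Evolution of the Weyl tensor -/

variable (L) in
/-- The tensor `S` for which the Weyl tensor is `Rm - S ∧ g`; here `c` stands for `1 / (n - 2)` and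
`c'` for `1 / (2 (n - 1) (n - 2))`. -/
def schouten (c c' : ℝ) : Matrix ι ι A := c • L.ric - c' • (L.scal • L.g)

variable (L) in
/-- The Weyl tensor. -/
def weylTensor (c c' : ℝ) (i j k l : ι) : A := L.rm i j k l - kn L.g (L.schouten c c') i j k l

variable (L) in
lemma hess2_smul_metric (p q : ι) (f : A) : L.hess2 p q (f • L.g) = L.hess0 p q f • L.g := by
  simp only [hess2, Conn.cov2_smul_metric (L.compat _), hess0, sub_smul, Finset.sum_smul, smul_smul]

variable (L) in
lemma lap2_schouten (c c' : ℝ) : L.lap2 (L.schouten c c')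
    = c • L.lap2 L.ric - c' • (L.lap0 L.scal • L.g) := by
  have h : ∀ p q, L.hess2 p q (L.schouten c c')
      = c • L.hess2 p q L.ric - c' • L.hess2 p q (L.scal • L.g) := by
    intro p q
    simp only [hess2, schouten, Conn.cov2_sub, Conn.cov2_smul, smul_sub, Finset.sum_sub_distrib,
      Finset.smul_sum, smul_comm _ c, smul_comm _ c']
    abel
  simp only [lap2, lap0, h, hess2_smul_metric, smul_sub, Finset.sum_sub_distrib, Finset.smul_sum,
    Finset.sum_smul, smul_comm _ c, smul_comm _ c', smul_smul]

variable (L) in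
lemma lap4_weylTensor (c c' : ℝ) (i j k l : ι) : L.lap4 (L.weylTensor c c') i j k l
    = L.lap4 L.rm i j k l - kn L.g (L.lap2 (L.schouten c c')) i j k l := by
  have h1 : ∀ (q : ι), (L.conn q).cov4 (L.weylTensor c c') = fun i j k l =>
      (L.conn q).cov4 L.rm i j k l - kn L.g ((L.conn q).cov2 (L.schouten c c')) i j k l := by
    intro q
    funext i j k l
    rw [← Conn.cov4_kn (L.compat q), ← Conn.cov4_sub]; rfl
  have h2 : ∀ p q, L.hess4 p q (L.weylTensor c c') i j k l
      = L.hess4 p q L.rm i j k l - kn L.g (L.hess2 p q (L.schouten c c')) i j k l := by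
    intro p q
    rw [hess4, h1, Conn.cov4_sub, Conn.cov4_kn (L.compat p)]
    simp only [h1, kn, hess2_apply, hess4, mul_sub, mul_add, Finset.sum_sub_distrib,
      Finset.sum_add_distrib, sub_mul, Finset.sum_mul, mul_assoc]
    ring
  simp only [lap4, h2, mul_sub, Finset.sum_sub_distrib]
  congr 1
  simp only [kn, lap2_apply, Finset.sum_mul, ← Finset.sum_sub_distrib, ← Finset.sum_add_distrib]
  exact Finset.sum_congr rfl fun _ _ => Finset.sum_congr rfl fun _ _ => by ring

/-- Evolution of the Weyl tensor, with the right-hand side written through the Riemann tensor. -/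
lemma IsFlow.cov4_weylTensor_sub_lap4 (ht : L.IsFlow t) (c c' : ℝ) (i j k l : ι) :
    t.cov4 (L.weylTensor c c') i j k l - L.lap4 (L.weylTensor c c') i j k l
      = hamiltonQuad L.ginv L.rm i j k l
        - kn L.g (c • trace24 L.ginv (hamiltonQuad L.ginv L.rm)
            - c' • (trace2 L.ginv (trace24 L.ginv (hamiltonQuad L.ginv L.rm)) • L.g)) i j k l := by
  have h1 : t.cov4 (L.weylTensor c c') i j k l
      = t.cov4 L.rm i j k l - kn L.g (t.cov2 (L.schouten c c')) i j k l := by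
    rw [← Conn.cov4_kn ht.compat, ← Conn.cov4_sub]; rfl
  have h2 : t.cov2 (L.schouten c c') = c • t.cov2 L.ric - c' • (t.der L.scal • L.g) := by
    simp only [schouten, Conn.cov2_sub, Conn.cov2_smul, Conn.cov2_smul_metric ht.compat]
  rw [h1, lap4_weylTensor, h2, lap2_schouten, ← ht.cov4_rm_sub_lap4, ← ht.der_scal_sub_lap0,
    ← ht.cov2_ric_sub_lap2]
  simp only [kn, Matrix.sub_apply, Matrix.smul_apply, smul_eq_mul]
  simp only [Algebra.smul_def]
  ring

end LeviCivita

/-! ### Decomposition of Hamilton's quadratic at a point -/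

section Pointwise

/-- In a sixfold sum over three pairs of indices, the outer and the inner pair may be renamed into
each other. -/
lemma sum_triple_swap {ι A : Type*} [Fintype ι] [AddCommMonoid A] (Z : ι → ι → ι → ι → ι → ι → A) :
    ∑ j, ∑ l, ∑ p, ∑ q, ∑ r, ∑ s, Z j l p q r s = ∑ j, ∑ l, ∑ p, ∑ q, ∑ r, ∑ s, Z r s p q j l := by
  simp only [← Fintype.sum_prod_type']
  exact Fintype.sum_equiv ⟨fun x => (x.2.2.2.2.1, x.2.2.2.2.2, x.2.2.1, x.2.2.2.1, x.1, x.2.1),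
    fun x => (x.2.2.2.2.1, x.2.2.2.2.2, x.2.2.1, x.2.2.2.1, x.1, x.2.1), fun _ => rfl,
    fun _ => rfl⟩ _ _ fun _ => rfl

lemma inner23_kn_transpose {ι A : Type*} [CommRing A] {h : Matrix ι ι A} (hhs : hᵀ = h)
    {S : Matrix ι ι A} (hS : Sᵀ = S) (i j : ι) :
    (inner23 (kn h S) i j)ᵀ = inner23 (kn h S) j i := by
  have h1 : ∀ a b, h a b = h b a := fun a b => congrFun (congrFun hhs b) a
  have h2 : ∀ a b, S a b = S b a := fun a b => congrFun (congrFun hS b) a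
  ext p r
  simp only [inner23, kn, transpose_apply, Matrix.of_apply]
  rw [h1 j i, h2 j i, h2 r p, h1 r p, h1 j r, h2 j r, h1 p i, h2 p i]
  ring

lemma curvatureLike_kn {ι A : Type*} [CommRing A] {h : Matrix ι ι A} (hhs : hᵀ = h)
    {S : Matrix ι ι A} (hS : Sᵀ = S) :
    CurvatureLike (kn h S) := by
  have h1 : ∀ a b, h a b = h b a := fun a b => congrFun (congrFun hhs b) a
  have h2 : ∀ a b, S a b = S b a := fun a b => congrFun (congrFun hS b) a
  refine ⟨fun i j k l => ?_, fun i j k l => ?_, fun i j k l => ?_, fun i j k l => ?_⟩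
  · simp only [kn]; ring
  · simp only [kn]; ring
  · simp only [kn]
    rw [h1 l j, h1 l i, h1 k i, h1 k j, h2 l j, h2 l i, h2 k i, h2 k j]; ring
  · simp only [kn]
    rw [h1 j i, h1 k i, h1 k j, h2 j i, h2 k i, h2 k j]; ring

lemma CurvatureLike.sub_kn {ι A : Type*} [CommRing A] {h : Matrix ι ι A}
    {T : ι → ι → ι → ι → A} (hT : CurvatureLike T) (hhs : hᵀ = h)
    {S : Matrix ι ι A} (hS : Sᵀ = S)
    {W : ι → ι → ι → ι → A} (hW : ∀ i j k l, W i j k l = T i j k l - kn h S i j k l) :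
    CurvatureLike W := by
  have hKS := curvatureLike_kn hhs hS
  refine ⟨fun i j k l => ?_, fun i j k l => ?_, fun i j k l => ?_, fun i j k l => ?_⟩
  · rw [hW, hW, hT.swap12, hKS.swap12]; ring
  · rw [hW, hW, hT.swap34, hKS.swap34]; ring
  · rw [hW, hW, hT.pair, hKS.pair]
  · rw [hW, hW, hW]; linear_combination hT.cyclic i j k l - hKS.cyclic i j k l

variable {ι A : Type*} [Fintype ι] [CommRing A] {h h' : Matrix ι ι A} {T : ι → ι → ι → ι → A}

lemma dot_smul_right (a : A) (X Y : Matrix ι ι A) : dot h' X (a • Y) = a * dot h' X Y := by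
  simp only [dot, Matrix.smul_apply, smul_eq_mul, Finset.mul_sum]
  exact Finset.sum_congr rfl fun _ _ => Finset.sum_congr rfl fun _ _ => Finset.sum_congr rfl
    fun _ _ => Finset.sum_congr rfl fun _ _ => by ring

lemma dot_sum_right {κ : Type*} (s : Finset κ) (X : Matrix ι ι A) (Y : κ → Matrix ι ι A) :
    dot h' X (∑ a ∈ s, Y a) = ∑ a ∈ s, dot h' X (Y a) := by
  classical
  induction s using Finset.induction_on with
  | empty => simp [dot]
  | insert a s ha ih => rw [Finset.sum_insert ha, Finset.sum_insert ha, dot_add_right, ih]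

lemma dot_sum_smul_right (X : Matrix ι ι A) (Y : ι → ι → Matrix ι ι A) :
    ∑ j, ∑ l, h' j l * dot h' X (Y j l) = dot h' X (∑ j, ∑ l, h' j l • Y j l) := by
  simp only [dot_sum_right, dot_smul_right]

/-- The Ricci contraction of `T_{pijr}` over the two inner indices. -/
lemma CurvatureLike.sum_smul_inner23 (hT : CurvatureLike T) :
    ∑ j, ∑ l, h' j l • inner23 T j l = -trace24 h' T := by
  ext p r
  simp only [Matrix.sum_apply, Matrix.smul_apply, inner23, trace24, Matrix.of_apply, smul_eq_mul,
    Matrix.neg_apply, ← Finset.sum_neg_distrib]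
  refine Finset.sum_congr rfl fun j _ => Finset.sum_congr rfl fun l _ => ?_
  rw [hT.swap34 p j l r]; ring

/-- The Ricci contraction of Hamilton's quadratic is `-2 R_{pikr} R^{pr}`. The remaining terms
cancel by the first Bianchi identity. -/
lemma CurvatureLike.trace24_hamiltonQuad (hT : CurvatureLike T) (hs : h'ᵀ = h') (i k : ι) :
    trace24 h' (hamiltonQuad h' T) i k = -2 * dot h' (inner23 T i k) (trace24 h' T) := by
  have hsw : ∀ a b, h' a b = h' b a := fun a b => congrFun (congrFun hs b) a
  have hV : ∑ j, ∑ l, h' j l * dot h' (inner23 T i k) (inner23 T j l)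
      = -dot h' (inner23 T i k) (trace24 h' T) := by
    rw [dot_sum_smul_right, hT.sum_smul_inner23, dot_neg_right]
  have hZ : ∑ j, ∑ l, h' j l * dot h' (inner23 T i l) (inner23 T j k)
      = ∑ j, ∑ l, h' j l * dot h' (inner23 T i j) (inner23 T l k) := by
    rw [Finset.sum_comm]
    exact Finset.sum_congr rfl fun j _ => Finset.sum_congr rfl fun l _ => by rw [hsw]
  -- The first Bianchi identity: `T q k l s = T q l k s - T q s k l`.
  have hX : ∑ j, ∑ l, h' j l * dot h' (inner23 T i j) (inner23 T k l)
      = ∑ j, ∑ l, h' j l * dot h' (inner23 T i j) (inner23 T l k)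
        + ∑ j, ∑ l, h' j l * dot h' (inner23 T i j) (inner23 T l k) := by
    have e1 : ∀ l, inner23 T k l = inner23 T l k - Matrix.of fun q s => T q s k l := by
      intro l; ext q s
      simp only [inner23, Matrix.of_apply, Matrix.sub_apply]
      linear_combination hT.swap12 q k l s + hT.pair q s k l + hT.swap12 k l q s
        - hT.cyclic k q l s
    have e2 : ∑ j, ∑ l, h' j l * dot h' (inner23 T i j) (Matrix.of fun q s => T q s k l)
        = -∑ j, ∑ l, h' j l * dot h' (inner23 T i j) (inner23 T l k) := by
      simp only [dot, Finset.mul_sum, ← Finset.sum_neg_distrib]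
      rw [sum_triple_swap]
      refine Finset.sum_congr rfl fun j _ => Finset.sum_congr rfl fun l _ => ?_
      refine Finset.sum_congr rfl fun p _ => Finset.sum_congr rfl fun q _ => ?_
      refine Finset.sum_congr rfl fun r _ => Finset.sum_congr rfl fun s _ => ?_
      simp only [inner23, Matrix.of_apply]
      rw [hT.swap34 p i r j]; ring
    simp only [e1 _, dot_sub_right, mul_sub, Finset.sum_sub_distrib, e2, sub_neg_eq_add]
  have hexp : trace24 h' (hamiltonQuad h' T) i k
      = 2 * (∑ j, ∑ l, h' j l * dot h' (inner23 T i j) (inner23 T k l)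
        - ∑ j, ∑ l, h' j l * dot h' (inner23 T i j) (inner23 T l k)
        + ∑ j, ∑ l, h' j l * dot h' (inner23 T i k) (inner23 T j l)
        - ∑ j, ∑ l, h' j l * dot h' (inner23 T i l) (inner23 T j k)) := by
    simp only [trace24, hamiltonQuad, Matrix.of_apply, ← Finset.sum_sub_distrib,
      ← Finset.sum_add_distrib, Finset.mul_sum]
    exact Finset.sum_congr rfl fun j _ => Finset.sum_congr rfl fun l _ => by ring
  rw [hexp, hX, hV, hZ]
  ring

/-- The double Ricci contraction of Hamilton's quadratic is `2 |Ric|²`. -/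
lemma CurvatureLike.trace2_trace24_hamiltonQuad (hT : CurvatureLike T) (hs : h'ᵀ = h') :
    trace2 h' (trace24 h' (hamiltonQuad h' T)) = 2 * dot h' (trace24 h' T) (trace24 h' T) := by
  have : trace2 h' (trace24 h' (hamiltonQuad h' T))
      = -2 * ∑ i, ∑ k, h' i k * dot h' (trace24 h' T) (inner23 T i k) := by
    simp only [trace2, hT.trace24_hamiltonQuad hs, Finset.mul_sum, dot_comm hs (trace24 h' T)]
    exact Finset.sum_congr rfl fun j _ => Finset.sum_congr rfl fun l _ => by ring
  rw [this, dot_sum_smul_right, hT.sum_smul_inner23, dot_neg_right]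
  ring

lemma trace2_add (X Y : Matrix ι ι A) : trace2 h' (X + Y) = trace2 h' X + trace2 h' Y := by
  simp only [trace2, Matrix.add_apply, mul_add, Finset.sum_add_distrib]

lemma trace2_neg (X : Matrix ι ι A) : trace2 h' (-X) = -trace2 h' X := by
  simp only [trace2, Matrix.neg_apply, mul_neg, Finset.sum_neg_distrib]

lemma trace2_sub (X Y : Matrix ι ι A) : trace2 h' (X - Y) = trace2 h' X - trace2 h' Y := by
  rw [sub_eq_add_neg, trace2_add, trace2_neg, ← sub_eq_add_neg]

lemma trace2_smul (a : A) (X : Matrix ι ι A) : trace2 h' (a • X) = a * trace2 h' X := by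
  simp only [trace2, Matrix.smul_apply, smul_eq_mul, Finset.mul_sum]
  exact Finset.sum_congr rfl fun _ _ => Finset.sum_congr rfl fun _ _ => by ring

lemma CurvatureLike.trace2_inner23 (hT : CurvatureLike T) (i j : ι) :
    trace2 h' (inner23 T i j) = -trace24 h' T i j := by
  simp only [trace2, trace24, inner23, Matrix.of_apply, ← Finset.sum_neg_distrib]
  refine Finset.sum_congr rfl fun p _ => Finset.sum_congr rfl fun r _ => ?_
  rw [hT.swap12]; ring

lemma trace24_symm (hT : CurvatureLike T) (hs : h'ᵀ = h') : (trace24 h' T)ᵀ = trace24 h' T := by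
  have hsw : ∀ a b, h' a b = h' b a := fun a b => congrFun (congrFun hs b) a
  ext i k
  simp only [trace24, transpose_apply, Matrix.of_apply]
  rw [Finset.sum_comm]
  refine Finset.sum_congr rfl fun j _ => Finset.sum_congr rfl fun l _ => ?_
  rw [hsw l j, hT.pair]

variable [DecidableEq ι]

lemma dot_prod_left (hhs : hᵀ = h) (hh : h * h' = 1) (X S : Matrix ι ι A) (k l : ι) :
    dot h' X (Matrix.of fun q s => S q l * h k s) = (Xᵀ * h' * S) k l := by
  have hδ : ∀ r, ∑ s, h' r s * h k s = (1 : Matrix ι ι A) r k := by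
    intro r
    have h1 : h' * h = 1 := mul_eq_one_comm.1 hh
    rw [← h1, Matrix.mul_apply]
    exact Finset.sum_congr rfl fun s _ => by rw [← congrFun (congrFun hhs k) s, transpose_apply]
  calc dot h' X (Matrix.of fun q s => S q l * h k s)
      = ∑ p, ∑ q, ∑ r, h' p q * X p r * S q l * ∑ s, h' r s * h k s := by
        simp only [dot, Matrix.of_apply, Finset.mul_sum]
        exact Finset.sum_congr rfl fun _ _ => Finset.sum_congr rfl fun _ _ => Finset.sum_congr rfl
          fun _ _ => Finset.sum_congr rfl fun _ _ => by ring
    _ = ∑ p, ∑ q, h' p q * X p k * S q l := by simp [hδ, Matrix.one_apply]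
    _ = _ := by
        simp only [Matrix.mul_apply, transpose_apply, Finset.sum_mul]
        rw [Finset.sum_comm]
        exact Finset.sum_congr rfl fun _ _ => Finset.sum_congr rfl fun _ _ => by ring

lemma dot_prod_right (hhs : hᵀ = h) (hh : h * h' = 1) (X S : Matrix ι ι A) (hS : Sᵀ = S)
    (k l : ι) :
    dot h' X (Matrix.of fun q s => S k s * h q l) = (X * h' * S) l k := by
  rw [← transpose_transpose X, ← dot_prod_left hhs hh, ← dot_transpose, transpose_transpose]
  congr 1
  ext q s
  simp only [transpose_apply, Matrix.of_apply]
  rw [← congrFun (congrFun hS k) q, ← congrFun (congrFun hhs l) s, transpose_apply, transpose_apply]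

lemma dot_metric (hhs : hᵀ = h) (hh : h * h' = 1) (X : Matrix ι ι A) :
    dot h' X h = trace2 h' X := by
  have hδ : ∀ q r, ∑ s, h' r s * h q s = (1 : Matrix ι ι A) r q := by
    intro q r
    have h1 : h' * h = 1 := mul_eq_one_comm.1 hh
    rw [← h1, Matrix.mul_apply]
    exact Finset.sum_congr rfl fun s _ => by rw [← congrFun (congrFun hhs q) s, transpose_apply]
  calc dot h' X h = ∑ p, ∑ q, ∑ r, h' p q * X p r * ∑ s, h' r s * h q s := by
        simp only [dot, Finset.mul_sum]
        exact Finset.sum_congr rfl fun _ _ => Finset.sum_congr rfl fun _ _ => Finset.sum_congr rfl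
          fun _ _ => Finset.sum_congr rfl fun _ _ => by ring
    _ = _ := by simp [hδ, Matrix.one_apply, trace2]

/-- Contraction of a 2-tensor with `(S ∧ g)_{qkls}`. -/
lemma dot_inner23_kn (hhs : hᵀ = h) (hh : h * h' = 1) (X S : Matrix ι ι A) (hS : Sᵀ = S)
    (k l : ι) : dot h' X (inner23 (kn h S) k l)
      = (Xᵀ * h' * S) k l - h k l * dot h' X S + (X * h' * S) l k - S k l * trace2 h' X := by
  have : inner23 (kn h S) k l = (Matrix.of fun q s => S q l * h k s) - h k l • S
      + (Matrix.of fun q s => S k s * h q l) - S k l • h := by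
    ext q s
    simp only [inner23, kn, Matrix.of_apply, Matrix.sub_apply, Matrix.add_apply, Matrix.smul_apply,
      smul_eq_mul]
    ring
  rw [this, dot_sub_right, dot_add_right, dot_sub_right, dot_smul_right, dot_smul_right,
    dot_prod_left hhs hh, dot_prod_right hhs hh X S hS, dot_metric hhs hh]

lemma inner23_kn_transpose_mul (hhs : hᵀ = h) (hh : h * h' = 1) {S : Matrix ι ι A} (hS : Sᵀ = S)
    (i j k l : ι) : ((inner23 (kn h S) i j)ᵀ * h' * S) k l
      = h i k * (S * h' * S) j l - h i j * (S * h' * S) k l + S i k * S j l - S i j * S k l := by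
  have e1 : ∀ a, ∑ p, S p a * (h' * S) p l = (S * h' * S) a l := by
    intro a
    rw [mul_assoc, Matrix.mul_apply]
    exact Finset.sum_congr rfl fun p _ => by rw [← congrFun (congrFun hS a) p, transpose_apply]
  have e2 : ∀ a, ∑ p, h p a * (h' * S) p l = S a l := by
    intro a
    have : h * (h' * S) = S := by rw [← mul_assoc, hh, one_mul]
    conv_rhs => rw [← this, Matrix.mul_apply]
    exact Finset.sum_congr rfl fun p _ => by rw [← congrFun (congrFun hhs a) p, transpose_apply]
  rw [mul_assoc, Matrix.mul_apply, ← e1, ← e1, ← e2 j, ← e2 k, Finset.mul_sum, Finset.mul_sum,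
    Finset.mul_sum, Finset.mul_sum, ← Finset.sum_sub_distrib, ← Finset.sum_add_distrib,
    ← Finset.sum_sub_distrib]
  refine Finset.sum_congr rfl fun p _ => ?_
  simp only [inner23, kn, transpose_apply, Matrix.of_apply]
  ring

lemma trace2_metric (hhs : hᵀ = h) (hh : h * h' = 1) : trace2 h' h = (Fintype.card ι : A) := by
  have h1 : h' * h = 1 := mul_eq_one_comm.1 hh
  have e : ∀ i, ∑ k, h' i k * h i k = 1 := by
    intro i
    rw [← Matrix.one_apply_eq (α := A) i, ← h1, Matrix.mul_apply]
    exact Finset.sum_congr rfl fun k _ => by rw [← congrFun (congrFun hhs i) k, transpose_apply]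
  simp [trace2, e]

lemma trace2_inner23_kn (hhs : hᵀ = h) (hh : h * h' = 1) (hs : h'ᵀ = h')
    {S : Matrix ι ι A} (hS : Sᵀ = S)
    (i j : ι) : trace2 h' (inner23 (kn h S) i j)
      = (2 - (Fintype.card ι : A)) * S i j - trace2 h' S * h i j := by
  have h1 := dot_inner23_kn hhs hh h S hS i j
  rw [dot_comm hs h, dot_comm hs h, dot_metric hhs hh, dot_metric hhs hh, hhs, hh, one_mul,
    trace2_metric hhs hh, show S j i = S i j from congrFun (congrFun hS i) j] at h1
  rw [h1]
  ring

/-- If `T = W + S ∧ h` with `W` trace-free, then in Hamilton's quadratic of `T` all contractions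
`S_a^p W_{pbcd}` cancel. -/
lemma hamiltonQuad_add_kn (hhs : hᵀ = h) (hh : h * h' = 1) (hs : h'ᵀ = h') {S : Matrix ι ι A}
    (hS : Sᵀ = S) {W : ι → ι → ι → ι → A} (hW : CurvatureLike W)
    (htr : ∀ i j, trace2 h' (inner23 W i j) = 0)
    (hT : ∀ i j k l, T i j k l = W i j k l + kn h S i j k l) (i j k l : ι) :
    hamiltonQuad h' T i j k l = hamiltonQuad h' W i j k l
      - 2 * kn h (Matrix.of fun a b => dot h' (inner23 W a b) S) i j k l
      - 2 * kn h (S * h' * S) i j k l + 2 * trace2 h' S * kn h S i j k l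
      + 2 * ((Fintype.card ι : A) - 2) * (S i k * S j l - S i l * S j k)
      + 2 * dot h' S S * (h i k * h j l - h i l * h j k) := by
  have hhs' : ∀ a b, h a b = h b a := fun a b => congrFun (congrFun hhs b) a
  have hS' : ∀ a b, S a b = S b a := fun a b => congrFun (congrFun hS b) a
  set Q := S * h' * S with hQ
  have hQ' : ∀ a b, Q a b = Q b a := fun a b => by
    have : Qᵀ = Q := by rw [hQ, transpose_mul, transpose_mul, hS, hs, mul_assoc]
    exact congrFun (congrFun this b) a
  have hω : ∀ a b, dot h' (inner23 W a b) S = dot h' (inner23 W b a) S := by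
    intro a b
    rw [hW.inner23_swap b a, ← dot_transpose, transpose_transpose, hS]
  -- The contraction of `S` with an outer index of `W`, antisymmetric in the last two arguments.
  let U : ι → ι → ι → ι → A := fun a b c d => ((inner23 W b c)ᵀ * h' * S) d a
  have hU : ∀ a b c d, U a b c d = -U a b d c := by
    intro a b c d
    simp only [U, mul_assoc]
    rw [Matrix.mul_apply, Matrix.mul_apply, ← Finset.sum_neg_distrib]
    refine Finset.sum_congr rfl fun p _ => ?_
    simp only [inner23, transpose_apply, Matrix.of_apply]
    rw [hW.swap34]; ring
  have hWK : ∀ i j k l, dot h' (inner23 W i j) (inner23 (kn h S) k l)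
      = U l i j k - h k l * dot h' (inner23 W i j) S + U k j i l := by
    intro i j k l
    rw [dot_inner23_kn hhs hh _ S hS, htr, mul_zero, sub_zero]
    simp only [U]
    rw [← hW.inner23_swap j i]
  have hKK : ∀ i j k l, dot h' (inner23 (kn h S) i j) (inner23 (kn h S) k l)
      = h i k * Q j l + h j l * Q i k - 2 * h i j * Q k l - 2 * h k l * Q i j + 2 * S i k * S j l
        - (4 - (Fintype.card ι : A)) * S i j * S k l + dot h' S S * h i j * h k l
        + trace2 h' S * (h k l * S i j + h i j * S k l) := by
    intro i j k l
    have hd : dot h' (inner23 (kn h S) i j) S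
        = 2 * Q i j - dot h' S S * h i j - trace2 h' S * S i j := by
      rw [dot_comm hs, dot_inner23_kn hhs hh _ S hS, hS, ← hQ, hQ' j i]
      ring
    rw [dot_inner23_kn hhs hh _ S hS, inner23_kn_transpose_mul hhs hh hS,
      ← inner23_kn_transpose hhs hS j i, inner23_kn_transpose_mul hhs hh hS,
      inner23_kn_transpose hhs hS j i, trace2_inner23_kn hhs hh hs hS, ← hQ, hd, hQ' l k, hS' l k,
      hS' j i, hhs' j i]
    ring
  have hin : ∀ i j, inner23 T i j = inner23 W i j + inner23 (kn h S) i j := by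
    intro i j; ext p r; exact hT _ _ _ _
  have hB : ∀ i j k l, dot h' (inner23 T i j) (inner23 T k l)
      = dot h' (inner23 W i j) (inner23 W k l)
        + (U l i j k - h k l * dot h' (inner23 W i j) S + U k j i l)
        + (U j k l i - h i j * dot h' (inner23 W k l) S + U i l k j)
        + dot h' (inner23 (kn h S) i j) (inner23 (kn h S) k l) := by
    intro i j k l
    rw [hin, hin, dot_add_left, dot_add_right, dot_add_right, hWK,
      dot_comm hs (inner23 (kn h S) i j) (inner23 W k l), hWK]
    ring
  simp only [hamiltonQuad, hB, hKK, kn, Matrix.of_apply]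
  rw [hU l i k j, hU l j k i, hU k j l i, hU k i l j, hU j k i l, hU j l i k, hU i l j k,
    hU i k j l,
    hω l k, hhs' l k, hQ' l k, hS' l k]
  ring

/-- The right-hand side of the evolution equation of the Weyl tensor, from that of the Riemann
tensor. -/
theorem weyl_reaction {h h' : Matrix ι ι ℝ} {T : ι → ι → ι → ι → ℝ} (hhs : hᵀ = h)
    (hh : h * h' = 1) (hs : h'ᵀ = h') (hT : CurvatureLike T) {n : ℝ} (hn : (Fintype.card ι : ℝ) = n)
    (h1 : n - 1 ≠ 0) (h2 : n - 2 ≠ 0) {Ric S : Matrix ι ι ℝ} {R : ℝ} {W : ι → ι → ι → ι → ℝ}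
    (hRic : Ric = trace24 h' T) (hR : R = trace2 h' Ric)
    (hS : S = (1 / (n - 2)) • Ric - (1 / (2 * (n - 1) * (n - 2))) • (R • h))
    (hW : ∀ i j k l, W i j k l = T i j k l - kn h S i j k l) (i j k l : ι) :
    hamiltonQuad h' T i j k l
        - kn h ((1 / (n - 2)) • trace24 h' (hamiltonQuad h' T)
            - (1 / (2 * (n - 1) * (n - 2))) •
              (trace2 h' (trace24 h' (hamiltonQuad h' T)) • h)) i j k l
      = hamiltonQuad h' W i j k l + 2 / (n - 2) ^ 2 * kn h (Ric * h' * Ric) i j k l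
        - 2 * R / (n - 2) ^ 2 * kn h Ric i j k l
        + 2 / (n - 2) * (Ric i k * Ric j l - Ric j k * Ric i l)
        + 2 * (R ^ 2 - dot h' Ric Ric) / ((n - 1) * (n - 2) ^ 2)
          * (h i k * h j l - h i l * h j k) := by
  have hRics : Ricᵀ = Ric := by rw [hRic, trace24_symm hT hs]
  have hSs : Sᵀ = S := by
    rw [hS, transpose_sub, transpose_smul, transpose_smul, transpose_smul, hRics, hhs]
  have hWc : CurvatureLike W := hT.sub_kn hhs hSs hW
  have hTW : ∀ i j k l, T i j k l = W i j k l + kn h S i j k l := fun i j k l => by rw [hW]; ring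
  -- In terms of `S` and its trace `σ`, the Ricci tensor is `(n - 2) S + σ h` and `R = 2 (n - 1) σ`.
  set σ := trace2 h' S with hσ
  have hRσ : R = 2 * (n - 1) * σ := by
    rw [hσ, hS, trace2_sub, trace2_smul, trace2_smul, trace2_smul, ← hR, trace2_metric hhs hh, hn]
    field_simp
    ring
  have hRicS : Ric = (n - 2) • S + σ • h := by
    ext a b
    rw [hS]
    simp only [Matrix.add_apply, Matrix.sub_apply, Matrix.smul_apply, smul_eq_mul, hRσ]
    field_simp
    ring
  have htr : ∀ i j, trace2 h' (inner23 W i j) = 0 := by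
    intro i j
    have e : inner23 W i j = inner23 T i j - inner23 (kn h S) i j := by
      ext p r; exact hW _ _ _ _
    rw [e, trace2_sub, hT.trace2_inner23, ← hRic, trace2_inner23_kn hhs hh hs hSs, hRicS, hn, ← hσ]
    simp only [Matrix.add_apply, Matrix.smul_apply, smul_eq_mul]
    ring
  have hin : ∀ i j, inner23 T i j = inner23 W i j + inner23 (kn h S) i j := by
    intro i j; ext p r; exact hTW _ _ _ _
  set Q := S * h' * S with hQ
  have hQs : ∀ a b, Q a b = Q b a := fun a b => by
    have : Qᵀ = Q := by rw [hQ, transpose_mul, transpose_mul, hSs, hs, mul_assoc]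
    exact congrFun (congrFun this b) a
  have hdSh : dot h' S h = σ := dot_metric hhs hh S
  have hdhS : dot h' h S = σ := by rw [dot_comm hs, hdSh]
  have hdhh : dot h' h h = n := by rw [dot_metric hhs hh, trace2_metric hhs hh, hn]
  have hsm : ∀ (a : ℝ) (X Y : Matrix ι ι ℝ), dot h' (a • X) Y = a * dot h' X Y := by
    intro a X Y
    rw [dot_comm hs, dot_smul_right, dot_comm hs]
  have hRR : dot h' Ric Ric
      = (n - 2) ^ 2 * dot h' S S + 2 * (n - 2) * σ ^ 2 + σ ^ 2 * n := by
    rw [hRicS]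
    simp only [dot_add_left, dot_add_right, dot_smul_right, hsm, hdSh, hdhS, hdhh]
    ring
  have hRic2 : Ric * h' * Ric = (n - 2) ^ 2 • Q + (2 * (n - 2) * σ) • S + σ ^ 2 • h := by
    have e1 : S * h' * h = S := by rw [mul_assoc, mul_eq_one_comm.1 hh, mul_one]
    rw [hRicS]
    simp only [add_mul, mul_add, Matrix.smul_mul, Matrix.mul_smul, hh, e1, one_mul, ← hQ, smul_smul]
    module
  have hLR : ∀ a b, trace24 h' (hamiltonQuad h' T) a b
      = -2 * ((n - 2) * dot h' (inner23 W a b) S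
        + ((n - 2) * (2 * Q a b - dot h' S S * h a b - σ * S a b)
          + σ * ((2 - n) * S a b - σ * h a b))) := by
    intro a b
    have hd : dot h' (inner23 (kn h S) a b) S
        = 2 * Q a b - dot h' S S * h a b - σ * S a b := by
      rw [dot_comm hs, dot_inner23_kn hhs hh _ S hSs, hSs, ← hQ, hQs b a,
        ← hσ]
      ring
    rw [hT.trace24_hamiltonQuad hs, ← hRic, hRicS, hin, dot_add_left, dot_add_right, dot_add_right,
      dot_smul_right, dot_smul_right, dot_smul_right, dot_smul_right, hd, dot_metric hhs hh,
      dot_metric hhs hh, htr, trace2_inner23_kn hhs hh hs hSs, hn]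
    ring
  rw [hT.trace2_trace24_hamiltonQuad hs, ← hRic, hRR, hRic2,
    hamiltonQuad_add_kn hhs hh hs hSs hWc htr hTW, hRσ, hRicS, ← hQ, ← hσ, hn]
  simp only [kn, Matrix.add_apply, Matrix.sub_apply, Matrix.smul_apply, smul_eq_mul, hLR,
    Matrix.of_apply]
  field_simp
  ring

end Pointwise

/-! ### The Levi-Civita connection of a metric -/

section OfMetric

variable {ι A : Type*} [Fintype ι] [CommRing A] [Algebra ℝ A]

/-- The direction `∂_p` with the Christoffel symbols of `g` as connection matrix. -/
def christoffelConn (g ginv : Matrix ι ι A) (d : ι → Derivation ℝ A A) (p : ι) : Conn ι A where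
  der := d p
  form := Matrix.of fun m q =>
    (1 / 2 : ℝ) • ∑ l, ginv m l * (d p (g q l) + d q (g p l) - d l (g p q))

/-- The Levi-Civita connection of the metric `g`. -/
def LeviCivita.ofMetric [DecidableEq ι] (g ginv : Matrix ι ι A) (d : ι → Derivation ℝ A A)
    (hg : gᵀ = g) (hh : g * ginv = 1) (hd : ∀ p q x, d p (d q x) = d q (d p x)) :
    LeviCivita ι A where
  g := g
  ginv := ginv
  conn := christoffelConn g ginv d
  g_symm := hg
  g_mul_ginv := hh
  comm p q x := hd p q x
  compat p := by
    have hs : ∀ a b, g a b = g b a := fun a b => congrFun (congrFun hg b) a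
    have hlow : ∀ i j, (g * (christoffelConn g ginv d p).form) i j
        = (1 / 2 : ℝ) • (d p (g j i) + d j (g p i) - d i (g p j)) := by
      intro i j
      let v : ι → A := fun l => d p (g j l) + d j (g p l) - d l (g p j)
      have e : (g * (christoffelConn g ginv d p).form) i j
          = (1 / 2 : ℝ) • (g *ᵥ (ginv *ᵥ v)) i := by
        simp only [Matrix.mul_apply, christoffelConn, Matrix.of_apply, Matrix.mulVec, dotProduct, v,
          mul_smul_comm]
        rw [Finset.smul_sum]
      rw [e, Matrix.mulVec_mulVec, hh, Matrix.one_mulVec]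
    ext i j
    have htr : (christoffelConn g ginv d p).formᵀ * g
        = (g * (christoffelConn g ginv d p).form)ᵀ := by
      rw [transpose_mul, hg]
    rw [htr, Matrix.add_apply, transpose_apply, hlow, hlow, ← smul_add, dMat_apply, hs j i, hs p i,
      hs p j]
    have : d p (g i j) + d i (g j p) - d j (g i p) + (d p (g i j) + d j (g i p) - d i (g j p))
        = (2 : ℝ) • d p (g i j) := by rw [two_smul]; ring
    rw [this, smul_smul]
    norm_num
    rfl
  torsion_free p q m := by
    have hs : ∀ a b, g a b = g b a := fun a b => congrFun (congrFun hg b) a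
    simp only [christoffelConn, Matrix.of_apply]
    congr 1
    refine Finset.sum_congr rfl fun l _ => ?_
    rw [hs p q]; ring

/-- The time direction of a Ricci flow, `Γ^m_i = -R^m_i`. -/
def LeviCivita.timeConn [DecidableEq ι] (L : LeviCivita ι A) (dt : Derivation ℝ A A) :
    Conn ι A where
  der := dt
  form := -(L.ginv * L.ric)

lemma LeviCivita.isFlow_timeConn [DecidableEq ι] (L : LeviCivita ι A) (dt : Derivation ℝ A A)
    (hdt : ∀ i j, dt (L.g i j) = -2 * L.ric i j)
    (hcomm : ∀ p x, dt ((L.conn p).der x) = (L.conn p).der (dt x)) :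
    L.IsFlow (L.timeConn dt) where
  form_eq := rfl
  comm := hcomm
  compat := by
    unfold Conn.Compatible timeConn
    rw [transpose_neg, transpose_mul, L.ginv_symm, L.ric_symm, neg_mul, mul_neg, mul_assoc,
      L.ginv_mul_g, mul_one, ← mul_assoc, L.g_mul_ginv, one_mul]
    ext i j
    rw [dMat_apply, hdt, Matrix.add_apply, Matrix.neg_apply]
    ring

end OfMetric

/-! ### The ring of smooth functions on a set with unique differentials -/

section SmoothFunctions

/-- Extension by zero of a function on `S`. -/
def extendZero {E : Type*} {S : Set E} (f : S → ℝ) : E → ℝ := Function.extend Subtype.val f 0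

lemma extendZero_apply {E : Type*} {S : Set E} (f : S → ℝ) {q : E} (hq : q ∈ S) :
    extendZero f q = f ⟨q, hq⟩ :=
  Subtype.val_injective.extend_apply f 0 ⟨q, hq⟩

variable {E : Type*} [NormedAddCommGroup E] [NormedSpace ℝ E] {S : Set E}

variable (S) in
/-- The ring of functions on `S` that are smooth on `S` in the sense of one-sided derivatives. -/
def SmoothFun : Subalgebra ℝ (S → ℝ) where
  carrier := {f | ContDiffOn ℝ ∞ (extendZero f) S}
  mul_mem' {f g} hf hg := (ContDiffOn.mul hf hg).congr fun q hq => by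
    simp [extendZero_apply _ hq]
  add_mem' {f g} hf hg := (ContDiffOn.add hf hg).congr fun q hq => by
    simp [extendZero_apply _ hq]
  algebraMap_mem' r := (contDiffOn_const (c := r)).congr fun q hq => by
    simp [extendZero_apply _ hq]

namespace SmoothFun

/-- The restriction to `S` of a function that is smooth on `S`. -/
def ofContDiffOn (F : E → ℝ) (hF : ContDiffOn ℝ ∞ F S) : SmoothFun S :=
  ⟨fun q => F q, hF.congr fun _ hq => extendZero_apply _ hq⟩

/-- The smooth function on `S` as a function on the ambient space, zero outside of `S`. -/
def toFun (f : SmoothFun S) : E → ℝ := extendZero f.1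

lemma toFun_apply (f : SmoothFun S) {q : E} (hq : q ∈ S) : (toFun f) q = f.1 ⟨q, hq⟩ :=
  extendZero_apply _ hq

lemma contDiffOn_toFun (f : SmoothFun S) : ContDiffOn ℝ ∞ (toFun f) S := f.2

lemma hasFDerivWithinAt_toFun (f : SmoothFun S) {q : E} (hq : q ∈ S) :
    HasFDerivWithinAt (toFun f) (fderivWithin ℝ (toFun f) S q) S q :=
  ((contDiffOn_toFun f).differentiableOn (by simp) q hq).hasFDerivWithinAt

/-- Evaluation at a point of `S`. -/
def ev (q : S) : SmoothFun S →ₐ[ℝ] ℝ := (Pi.evalAlgHom ℝ (fun _ : S => ℝ) q).comp (SmoothFun S).val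

lemma ev_apply (q : S) (f : SmoothFun S) : ev q f = f.1 q := rfl

lemma ext_ev {f g : SmoothFun S} (h : ∀ q, ev q f = ev q g) : f = g :=
  Subtype.ext (funext h)

lemma toFun_eq_ev (f : SmoothFun S) (q : S) : (toFun f) q = ev q f := toFun_apply f q.2

/-- A nowhere vanishing smooth function is invertible. -/
lemma isUnit_of_ev_ne_zero (f : SmoothFun S) (h : ∀ q, ev q f ≠ 0) : IsUnit f := by
  have hne : ∀ q ∈ S, (toFun f) q ≠ 0 := fun q hq => by
    rw [toFun_eq_ev f ⟨q, hq⟩]; exact h _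
  refine IsUnit.of_mul_eq_one
    (ofContDiffOn (fun q => (toFun f q)⁻¹) ((contDiffOn_toFun f).inv hne)) ?_
  refine ext_ev fun q => ?_
  rw [map_mul, map_one, ← toFun_eq_ev f]
  exact mul_inv_cancel₀ (hne q q.2)

/-- Directional derivative of smooth functions on `S`. -/
def dirDeriv (hS : UniqueDiffOn ℝ S) (v : E) : Derivation ℝ (SmoothFun S) (SmoothFun S) :=
  Derivation.mk'
    { toFun := fun f => ofContDiffOn (fun q => fderivWithin ℝ (toFun f) S q v)
        (((contDiffOn_toFun f).fderivWithin hS (by simp)).clm_apply contDiffOn_const)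
      map_add' := fun f g => ext_ev fun q => by
        have h : HasFDerivWithinAt (toFun (f + g)) _ S q :=
          HasFDerivWithinAt.congr'
            ((hasFDerivWithinAt_toFun f q.2).add (hasFDerivWithinAt_toFun g q.2))
            (fun x hx => by simp [toFun_apply _ hx]) q.2
        simp only [ev_apply, ofContDiffOn, h.fderivWithin (hS q q.2)]
        rfl
      map_smul' := fun r f => ext_ev fun q => by
        have h : HasFDerivWithinAt (toFun (r • f)) _ S q :=
          HasFDerivWithinAt.congr' ((hasFDerivWithinAt_toFun f q.2).const_smul r)
            (fun x hx => by simp [toFun_apply _ hx]) q.2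
        simp only [ev_apply, ofContDiffOn, h.fderivWithin (hS q q.2)]
        rfl }
    fun f g => ext_ev fun q => by
      have h : HasFDerivWithinAt (toFun (f * g)) _ S q :=
        HasFDerivWithinAt.congr'
            ((hasFDerivWithinAt_toFun f q.2).mul (hasFDerivWithinAt_toFun g q.2))
          (fun x hx => by simp [toFun_apply _ hx]) q.2
      rw [map_add, smul_eq_mul, smul_eq_mul, map_mul (ev q) f, map_mul (ev q) g, ← toFun_eq_ev f,
        ← toFun_eq_ev g]
      simp only [ev_apply, ofContDiffOn, LinearMap.coe_mk, AddHom.coe_mk,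
        h.fderivWithin (hS q q.2)]
      simp

lemma ev_dirDeriv (hS : UniqueDiffOn ℝ S) (v : E) (f : SmoothFun S) (q : S) :
    ev q (dirDeriv hS v f) = fderivWithin ℝ (toFun f) S q v := rfl

lemma dirDeriv_comm (hS : UniqueDiffOn ℝ S) (hS' : S ⊆ closure (interior S)) (v w : E)
    (f : SmoothFun S) : dirDeriv hS v (dirDeriv hS w f) = dirDeriv hS w (dirDeriv hS v f) := by
  have key : ∀ (v w : E) (q : S), ev q (dirDeriv hS v (dirDeriv hS w f))
      = fderivWithin ℝ (fderivWithin ℝ (toFun f) S) S q v w := by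
    intro v w q
    have hd : DifferentiableWithinAt ℝ (fderivWithin ℝ (toFun f) S) S q :=
      ((contDiffOn_toFun f).fderivWithin hS (m := ∞) (by simp)).differentiableOn (by simp) q q.2
    have h : HasFDerivWithinAt (toFun (dirDeriv hS w f))
        ((fderivWithin ℝ (fderivWithin ℝ (toFun f) S) S q).flip w) S q := by
      refine HasFDerivWithinAt.congr' (f := fun x => fderivWithin ℝ (toFun f) S x w) ?_
        (fun x hx => toFun_apply _ hx) q.2
      have := hd.hasFDerivWithinAt.clm_apply (hasFDerivWithinAt_const w (q : E) S)
      simpa using this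
    rw [ev_dirDeriv, h.fderivWithin (hS q q.2)]
    rfl
  refine ext_ev fun q => ?_
  rw [key, key]
  have hc : ContDiffWithinAt ℝ ∞ (toFun f) S q := (contDiffOn_toFun f) q q.2
  exact (hc.isSymmSndFDerivWithinAt
    (by simpa using WithTop.coe_le_coe.2 (le_top : (2 : ℕ∞) ≤ ⊤)) hS (hS' q.2) q.2) v w

end SmoothFun

end SmoothFunctions

/-! ### Coordinate expressions as smooth functions of time and space -/

/-- A smooth family of metrics on an open set `U` of coordinate space, parametrized by an interval
`I`. -/
structure MetricFamily (n : ℕ) where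
  /-- The time interval. -/
  I : Set ℝ
  /-- The domain in coordinate space. -/
  U : Set (Coord n)
  /-- The components of the metric. -/
  G : ℝ → Coord n → Matrix (Fin n) (Fin n) ℝ
  ordConnected : I.OrdConnected
  nontrivial : I.Nontrivial
  isOpen : IsOpen U
  smooth : ∀ i j, ContDiffOn ℝ ∞ (fun q : ℝ × Coord n => G q.1 q.2 i j) (I ×ˢ U)
  symm : ∀ s ∈ I, ∀ z ∈ U, (G s z)ᵀ = G s z
  det_ne_zero : ∀ s ∈ I, ∀ z ∈ U, (G s z).det ≠ 0

namespace MetricFamily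

variable {n : ℕ} (F : MetricFamily n)

lemma convex : Convex ℝ F.I := F.ordConnected.convex

lemma interior_nonempty : (interior F.I).Nonempty := by
  obtain ⟨a, ha, b, hb, hab⟩ := F.nontrivial.exists_lt
  refine (Set.nonempty_Ioo.2 hab).mono ?_
  rw [← interior_Icc]
  exact interior_mono (F.ordConnected.out ha hb)

lemma uniqueDiffOn_I : UniqueDiffOn ℝ F.I := uniqueDiffOn_convex F.convex F.interior_nonempty

lemma uniqueDiffOn : UniqueDiffOn ℝ (F.I ×ˢ F.U) := F.uniqueDiffOn_I.prod F.isOpen.uniqueDiffOn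

lemma subset_closure_interior : F.I ×ˢ F.U ⊆ closure (interior (F.I ×ˢ F.U)) := by
  rw [interior_prod_eq, closure_prod_eq, F.isOpen.interior_eq,
    F.convex.closure_interior_eq_closure_of_nonempty_interior F.interior_nonempty]
  exact Set.prod_mono subset_closure subset_closure

/-- The ring of smooth functions of time and space. -/
abbrev Fun : Type := SmoothFun (F.I ×ˢ F.U)

/-- The partial derivative `∂_p` on functions of time and space. -/
def dx (p : Fin n) : Derivation ℝ F.Fun F.Fun := SmoothFun.dirDeriv F.uniqueDiffOn (0, basisVec p)

/-- The time derivative. -/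
def dt : Derivation ℝ F.Fun F.Fun := SmoothFun.dirDeriv F.uniqueDiffOn (1, 0)

/-- The metric with entries in the ring of smooth functions. -/
def metric : Matrix (Fin n) (Fin n) F.Fun :=
  Matrix.of fun i j => SmoothFun.ofContDiffOn (fun q => F.G q.1 q.2 i j) (F.smooth i j)

variable {F} in
/-- Evaluation at time `s` and at the point with coordinates `z`. -/
def evalAt {s : ℝ} (hs : s ∈ F.I) {z : Coord n} (hz : z ∈ F.U) : F.Fun →ₐ[ℝ] ℝ :=
  SmoothFun.ev ⟨(s, z), hs, hz⟩

variable {F} {s : ℝ} (hs : s ∈ F.I) {z : Coord n} (hz : z ∈ F.U)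

lemma ext_evalAt {a b : F.Fun} (h : ∀ s (hs : s ∈ F.I) z (hz : z ∈ F.U),
    evalAt hs hz a = evalAt hs hz b) : a = b :=
  SmoothFun.ext_ev fun q => h q.1.1 q.2.1 q.1.2 q.2.2

lemma mapMatrix_metric : (evalAt hs hz).toRingHom.mapMatrix F.metric = F.G s z := rfl

variable (F) in
lemma isUnit_det_metric : IsUnit F.metric.det := by
  refine SmoothFun.isUnit_of_ev_ne_zero _ fun q => ?_
  have h : SmoothFun.ev q F.metric.det = (F.G q.1.1 q.1.2).det := by
    change (evalAt q.2.1 q.2.2).toRingHom F.metric.det = _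
    rw [RingHom.map_det, mapMatrix_metric]
  rw [h]
  exact F.det_ne_zero _ q.2.1 _ q.2.2

variable (F) in
/-- The Levi-Civita connection of the family of metrics. -/
def leviCivita : LeviCivita (Fin n) F.Fun :=
  LeviCivita.ofMetric F.metric F.metric⁻¹ F.dx
    (by
      ext i j
      have : F.metric j i = F.metric i j :=
        ext_evalAt fun s hs z hz => congrFun (congrFun (F.symm s hs z hz) i) j
      rw [transpose_apply, this])
    (Matrix.mul_nonsing_inv _ F.isUnit_det_metric)
    (fun p q x => SmoothFun.dirDeriv_comm F.uniqueDiffOn F.subset_closure_interior _ _ x)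

lemma evalAt_g (i j : Fin n) : evalAt hs hz (F.leviCivita.g i j) = F.G s z i j := rfl

lemma invMetric_eq (i j : Fin n) :
    invMetric (F.G s) z i j = evalAt hs hz (F.leviCivita.ginv i j) := by
  have h := congrArg (evalAt hs hz).toRingHom.mapMatrix F.leviCivita.g_mul_ginv
  rw [map_mul, map_one] at h
  exact congrFun (congrFun (Matrix.inv_eq_right_inv (A := F.G s z) h) i) j

/-- A partial derivative in space is the evaluation of the corresponding derivation. -/
lemma partialDeriv_eq (i : Fin n) {f : Coord n → ℝ} {a : F.Fun}
    (h : ∀ w (hw : w ∈ F.U), f w = evalAt hs hw a) :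
    partialDeriv i f z = evalAt hs hz (F.dx i a) := by
  have h1 := SmoothFun.hasFDerivWithinAt_toFun a (q := (s, z)) ⟨hs, hz⟩
  have h2 : HasFDerivWithinAt (fun w : Coord n => (s, w))
      (ContinuousLinearMap.inr ℝ ℝ (Coord n)) F.U z :=
    (hasFDerivAt_prodMk_right s z).hasFDerivWithinAt
  have h4 : Set.MapsTo (fun w : Coord n => (s, w)) F.U (F.I ×ˢ F.U) := fun w hw => ⟨hs, hw⟩
  have h3 : HasFDerivWithinAt f _ F.U z :=
    (h1.comp z h2 h4).congr'
      (fun w hw => (h w hw).trans (SmoothFun.toFun_eq_ev a ⟨(s, w), hs, hw⟩).symm) hz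
  rw [partialDeriv, (h3.hasFDerivAt (F.isOpen.mem_nhds hz)).fderiv]
  rfl

/-- A one-sided time derivative is the evaluation of the time derivation. -/
lemma hasDerivWithinAt_of_eq {f : ℝ → ℝ} {a : F.Fun}
    (h : ∀ r (hr : r ∈ F.I), f r = evalAt hr hz a) :
    HasDerivWithinAt f (evalAt hs hz (F.dt a)) F.I s := by
  have h1 := SmoothFun.hasFDerivWithinAt_toFun a (q := (s, z)) ⟨hs, hz⟩
  have h2 : HasFDerivWithinAt (fun r : ℝ => (r, z))
      (ContinuousLinearMap.inl ℝ ℝ (Coord n)) F.I s :=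
    (hasFDerivAt_prodMk_left s z).hasFDerivWithinAt
  have h4 : Set.MapsTo (fun r : ℝ => (r, z)) F.I (F.I ×ˢ F.U) := fun r hr => ⟨hr, hz⟩
  have h3 : HasFDerivWithinAt f _ F.I s :=
    (h1.comp s h2 h4).congr'
      (fun r hr => (h r hr).trans (SmoothFun.toFun_eq_ev a ⟨(r, z), hr, hz⟩).symm) hs
  exact h3.hasDerivWithinAt

lemma christoffel_eq (k i j : Fin n) :
    christoffel (F.G s) z k i j = evalAt hs hz ((F.leviCivita.conn i).form k j) := by
  have h : ∀ a b c,
      partialDeriv a (fun w => F.G s w b c) z = evalAt hs hz (F.dx a (F.metric b c)) :=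
    fun a b c => partialDeriv_eq hs hz a fun w hw => rfl
  change _ = evalAt hs hz ((1 / 2 : ℝ) • ∑ l, F.leviCivita.ginv k l *
    (F.dx i (F.metric j l) + F.dx j (F.metric i l) - F.dx l (F.metric i j)))
  simp only [christoffel, h, invMetric_eq hs hz, map_smul, map_sum, map_mul, map_sub, map_add,
    smul_eq_mul]

/-- For coordinate fields the covariant derivative is a Christoffel symbol. -/
lemma nabla_const_const (G : Coord n → Matrix (Fin n) (Fin n) ℝ) (i k : Fin n) (w : Coord n)
    (m : Fin n) :
    nabla G (fun _ => basisVec i) (fun _ => basisVec k) w m = christoffel G w m i k := by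
  simp [nabla, basisVec, partialDeriv]

lemma nabla_const (G : Coord n → Matrix (Fin n) (Fin n) ℝ) (j : Fin n) (Z : Coord n → Coord n)
    (w : Coord n) (m : Fin n) :
    nabla G (fun _ => basisVec j) Z w m
      = partialDeriv j (fun v => Z v m) w + ∑ b, christoffel G w m j b * Z w b := by
  simp [nabla, basisVec]

lemma riemOp_eq (i j k m : Fin n) :
    riemOp (F.G s) (fun _ => basisVec i) (fun _ => basisVec j) (fun _ => basisVec k) z m
      = evalAt hs hz (Conn.curv (F.leviCivita.conn j) (F.leviCivita.conn i) m k) := by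
  have h0 : nabla (F.G s) (VectorField.lieBracket ℝ (fun _ : Coord n => (basisVec i : Coord n))
      (fun _ : Coord n => (basisVec j : Coord n))) (fun _ => basisVec k) z = 0 := by
    have : VectorField.lieBracket ℝ (fun _ : Coord n => (basisVec i : Coord n))
      (fun _ : Coord n => (basisVec j : Coord n)) = 0 := by
      ext1 v; simp [VectorField.lieBracket]
    rw [this]
    ext m; simp [nabla]
  have h1 : ∀ i j k m, nabla (F.G s) (fun _ => basisVec j)
      (nabla (F.G s) (fun _ => basisVec i) (fun _ => basisVec k)) z m
      = evalAt hs hz ((F.leviCivita.conn j).der ((F.leviCivita.conn i).form m k)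
        + ((F.leviCivita.conn j).form * (F.leviCivita.conn i).form) m k) := by
    intro i j k m
    rw [nabla_const]
    simp only [nabla_const_const]
    rw [partialDeriv_eq hs hz j fun w hw => christoffel_eq hs hw m i k, map_add, Matrix.mul_apply,
      map_sum]
    simp only [map_mul, christoffel_eq hs hz]
    rfl
  simp only [riemOp, PiLp.add_apply, PiLp.sub_apply, h0, PiLp.zero_apply, h1, Conn.curv,
    Matrix.add_apply, Matrix.sub_apply, dMat_apply, map_add, map_sub]
  ring

lemma riem_eq (i j k l : Fin n) :
    riem (F.G s) z i j k l = evalAt hs hz (F.leviCivita.rm i j k l) := by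
  simp only [riem, riemOp_eq hs hz, LeviCivita.rm, Matrix.mul_apply, map_sum, map_mul, evalAt_g]

lemma ricci_eq (i k : Fin n) : ricci (F.G s) z i k = evalAt hs hz (F.leviCivita.ric i k) := by
  simp only [ricci, riem_eq hs hz, invMetric_eq hs hz, LeviCivita.ric, trace24, Matrix.of_apply,
    map_sum, map_mul]

lemma scalarCurv_eq : scalarCurv (F.G s) z = evalAt hs hz F.leviCivita.scal := by
  simp only [scalarCurv, ricci_eq hs hz, invMetric_eq hs hz, LeviCivita.scal, trace2,
    map_sum, map_mul]

variable (F) in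
/-- The Weyl tensor with components in the ring of smooth functions. -/
def weylFun : Fin n → Fin n → Fin n → Fin n → F.Fun :=
  F.leviCivita.weylTensor (1 / ((n : ℝ) - 2)) (1 / (2 * ((n : ℝ) - 1) * ((n : ℝ) - 2)))

lemma weyl_eq (i j k l : Fin n) : weyl (F.G s) z i j k l = evalAt hs hz (F.weylFun i j k l) := by
  simp only [weyl, riem_eq hs hz, ricci_eq hs hz, scalarCurv_eq hs hz, weylFun,
    LeviCivita.weylTensor, kn, LeviCivita.schouten, map_sub, map_add, map_mul, Matrix.sub_apply,
    Matrix.smul_apply, map_smul, smul_eq_mul, evalAt_g, mul_inv, div_eq_mul_inv]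
  ring

lemma covDeriv_four {T : Coord n → (Fin 4 → Fin n) → ℝ}
    {a : Fin n → Fin n → Fin n → Fin n → F.Fun}
    (hT : ∀ w (hw : w ∈ F.U) i j k l, T w ![i, j, k, l] = evalAt hs hw (a i j k l))
    (q i j k l : Fin n) :
    covDeriv (F.G s) T z ![q, i, j, k, l]
      = evalAt hs hz ((F.leviCivita.conn q).cov4 a i j k l) := by
  have ht : Fin.tail ![q, i, j, k, l] = ![i, j, k, l] := rfl
  have u0 : ∀ m, Function.update ![i, j, k, l] 0 m = ![m, j, k, l] := fun m => by
    ext b; fin_cases b <;> rfl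
  have u1 : ∀ m, Function.update ![i, j, k, l] 1 m = ![i, m, k, l] := fun m => by
    ext b; fin_cases b <;> rfl
  have u2 : ∀ m, Function.update ![i, j, k, l] 2 m = ![i, j, m, l] := fun m => by
    ext b; fin_cases b <;> rfl
  have u3 : ∀ m, Function.update ![i, j, k, l] 3 m = ![i, j, k, m] := fun m => by
    ext b; fin_cases b <;> rfl
  have hd := partialDeriv_eq hs hz q fun w hw => hT w hw i j k l
  rw [covDeriv, ht, Fin.sum_univ_four]
  simp only [u0, u1, u2, u3]
  change partialDeriv q _ z - (∑ m, christoffel (F.G s) z m q i * _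
    + ∑ m, christoffel (F.G s) z m q j * _ + ∑ m, christoffel (F.G s) z m q k * _
    + ∑ m, christoffel (F.G s) z m q l * _) = _
  rw [hd]
  simp only [hT z hz, christoffel_eq hs hz, Conn.cov4, map_sub, map_sum, map_mul]
  change evalAt hs hz ((F.leviCivita.conn q).der _) - _ = _
  ring

lemma covDeriv_five {T : Coord n → (Fin 5 → Fin n) → ℝ}
    {b : Fin n → Fin n → Fin n → Fin n → Fin n → F.Fun}
    (hT : ∀ w (hw : w ∈ F.U) q i j k l, T w ![q, i, j, k, l] = evalAt hs hw (b q i j k l))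
    (p q i j k l : Fin n) :
    covDeriv (F.G s) T z ![p, q, i, j, k, l]
      = evalAt hs hz ((F.leviCivita.conn p).cov4 (b q) i j k l
      - ∑ m, (F.leviCivita.conn p).form m q * b m i j k l) := by
  have ht : Fin.tail ![p, q, i, j, k, l] = ![q, i, j, k, l] := rfl
  have u0 : ∀ m, Function.update ![q, i, j, k, l] 0 m = ![m, i, j, k, l] := fun m => by
    ext b; fin_cases b <;> rfl
  have u1 : ∀ m, Function.update ![q, i, j, k, l] 1 m = ![q, m, j, k, l] := fun m => by
    ext b; fin_cases b <;> rfl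
  have u2 : ∀ m, Function.update ![q, i, j, k, l] 2 m = ![q, i, m, k, l] := fun m => by
    ext b; fin_cases b <;> rfl
  have u3 : ∀ m, Function.update ![q, i, j, k, l] 3 m = ![q, i, j, m, l] := fun m => by
    ext b; fin_cases b <;> rfl
  have u4 : ∀ m, Function.update ![q, i, j, k, l] 4 m = ![q, i, j, k, m] := fun m => by
    ext b; fin_cases b <;> rfl
  have hd := partialDeriv_eq hs hz p fun w hw => hT w hw q i j k l
  rw [covDeriv, ht, Fin.sum_univ_five]
  simp only [u0, u1, u2, u3, u4]
  change partialDeriv p _ z - (∑ m, christoffel (F.G s) z m p q * _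
    + ∑ m, christoffel (F.G s) z m p i * _ + ∑ m, christoffel (F.G s) z m p j * _
    + ∑ m, christoffel (F.G s) z m p k * _ + ∑ m, christoffel (F.G s) z m p l * _) = _
  rw [hd]
  simp only [hT z hz, christoffel_eq hs hz, Conn.cov4, map_sub, map_sum, map_mul]
  change evalAt hs hz ((F.leviCivita.conn p).der _) - _ = _
  ring

lemma laplacianWeyl_eq (i j k l : Fin n) :
    laplacianWeyl (F.G s) z i j k l = evalAt hs hz (F.leviCivita.lap4 F.weylFun i j k l) := by
  have h4 : ∀ w (hw : w ∈ F.U) q i j k l,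
      covDeriv (F.G s) (fun v I => weyl (F.G s) v (I 0) (I 1) (I 2) (I 3)) w ![q, i, j, k, l]
        = evalAt hs hw ((F.leviCivita.conn q).cov4 F.weylFun i j k l) :=
    fun w hw q i j k l => covDeriv_four hs hw (fun v hv i j k l => weyl_eq hs hv i j k l) q i j k l
  have h5 : ∀ p q, covDeriv (F.G s) (covDeriv (F.G s)
      (fun v I => weyl (F.G s) v (I 0) (I 1) (I 2) (I 3))) z (Fin.cons p (Fin.cons q ![i, j, k, l]))
      = evalAt hs hz (F.leviCivita.hess4 p q F.weylFun i j k l) :=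
    fun p q => covDeriv_five hs hz h4 p q i j k l
  simp only [laplacianWeyl, laplacian, h5, LeviCivita.lap4, map_sum, map_mul, invMetric_eq hs hz]

variable (F) in
/-- The family of metrics solves the Ricci flow equation. -/
def IsRicciFlow : Prop := ∀ s ∈ F.I, ∀ z ∈ F.U, ∀ i j,
  HasDerivWithinAt (fun r => F.G r z i j) (-2 * ricci (F.G s) z i j) F.I s

lemma IsRicciFlow.isFlow (hF : F.IsRicciFlow) :
    F.leviCivita.IsFlow (F.leviCivita.timeConn F.dt) := by
  refine F.leviCivita.isFlow_timeConn F.dt (fun i j => ext_evalAt fun s hs z hz => ?_) fun p x =>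
    SmoothFun.dirDeriv_comm F.uniqueDiffOn F.subset_closure_interior _ _ x
  have h1 := hF s hs z hz i j
  have h2 : HasDerivWithinAt (fun r => F.G r z i j)
      (evalAt hs hz (F.dt (F.leviCivita.g i j))) F.I s :=
    hasDerivWithinAt_of_eq hs hz fun r hr => rfl
  rw [map_mul, map_neg, map_ofNat, ← ricci_eq hs hz]
  exact (F.uniqueDiffOn_I s hs).eq_deriv _ h2 h1

/-- Evolution of the Weyl tensor of a family of metrics in coordinates. -/
theorem IsRicciFlow.hasDerivWithinAt_weyl (hF : F.IsRicciFlow) (hn : 3 ≤ n) (hs : s ∈ F.I)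
    (hz : z ∈ F.U) (i j k l : Fin n) :
    let W := weyl (F.G s) z
    let D := weylQuad (F.G s) z
    let Ric := ricci (F.G s) z
    let R := scalarCurv (F.G s) z
    let h := F.G s z
    let h' := invMetric (F.G s) z
    HasDerivWithinAt (fun r => weyl (F.G r) z i j k l)
      (laplacianWeyl (F.G s) z i j k l
        + 2 * (D i j k l - D i j l k + D i k j l - D i l j k)
        - ∑ p, ∑ q, h' p q *
            (Ric i p * W q j k l + Ric j p * W i q k l + Ric k p * W i j q l + Ric l p * W i j k q)
        + 2 / ((n : ℝ) - 2) ^ 2 * ∑ p, ∑ q, h' p q *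
            (Ric i p * Ric q k * h j l - Ric i p * Ric q l * h j k
              + Ric j p * Ric q l * h i k - Ric j p * Ric q k * h i l)
        - 2 * R / ((n : ℝ) - 2) ^ 2 *
            (Ric i k * h j l - Ric i l * h j k + Ric j l * h i k - Ric j k * h i l)
        + 2 / ((n : ℝ) - 2) * (Ric i k * Ric j l - Ric j k * Ric i l)
        + 2 * (R ^ 2 - ricciNormSq (F.G s) z) / (((n : ℝ) - 1) * ((n : ℝ) - 2) ^ 2) *
            (h i k * h j l - h i l * h j k))
      F.I s := by
  intro W D Ric R h h'
  have hn' : (3 : ℝ) ≤ n := by exact_mod_cast hn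
  have hd : HasDerivWithinAt (fun r => weyl (F.G r) z i j k l)
      (evalAt hs hz (F.dt (F.weylFun i j k l))) F.I s :=
    hasDerivWithinAt_of_eq hs hz fun r hr => weyl_eq hr hz i j k l
  convert hd using 1
  set L := F.leviCivita with hL
  have hflow := hF.isFlow
  have hhs : hᵀ = h := F.symm s hs z hz
  have hh : h * h' = 1 := Matrix.mul_nonsing_inv _ (isUnit_iff_ne_zero.2 (F.det_ne_zero s hs z hz))
  have hs' : h'ᵀ = h' := by
    ext a b
    simp only [h', transpose_apply, invMetric_eq hs hz, F.leviCivita.ginv_swap b a]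
  have hsw : ∀ a b, h' a b = h' b a := fun a b => congrFun (congrFun hs' b) a
  let T : Fin n → Fin n → Fin n → Fin n → ℝ := riem (F.G s) z
  have hT : CurvatureLike T := by
    have hR := L.curvatureLike_rm
    refine ⟨fun i j k l => ?_, fun i j k l => ?_, fun i j k l => ?_, fun i j k l => ?_⟩ <;>
      simp only [T, riem_eq hs hz]
    · rw [← map_neg, ← hR.swap12]
    · rw [← map_neg, ← hR.swap34]
    · rw [← hR.pair]
    · rw [← map_add, ← map_add, hR.cyclic, map_zero]
  let RicM : Matrix (Fin n) (Fin n) ℝ := Matrix.of Ric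
  have hRic : RicM = trace24 h' T := rfl
  have hRics : ∀ a b, Ric a b = Ric b a := fun a b =>
    congrFun (congrFun (trace24_symm hT hs') b) a
  let S : Matrix (Fin n) (Fin n) ℝ :=
    (1 / ((n : ℝ) - 2)) • RicM - (1 / (2 * ((n : ℝ) - 1) * ((n : ℝ) - 2))) • (R • h)
  have hWT : ∀ i j k l, W i j k l = T i j k l - kn h S i j k l := by
    intro i j k l
    simp only [W, weyl, T, kn, S, RicM, Matrix.sub_apply, Matrix.smul_apply, Matrix.of_apply,
      smul_eq_mul, mul_inv, div_eq_mul_inv, Ric, R, h]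
    ring
  have hSs : Sᵀ = S := by
    ext a b
    have h1 : h b a = h a b := congrFun (congrFun hhs a) b
    simp only [S, RicM, transpose_apply, Matrix.sub_apply, Matrix.smul_apply, Matrix.of_apply,
      hRics b a, h1]
  have hWc : CurvatureLike W := hT.sub_kn hhs hSs hWT
  have hreact := weyl_reaction hhs hh hs' hT (n := (n : ℝ)) (by simp) (by linarith) (by linarith)
    hRic (R := R) rfl rfl hWT i j k l
  have hD : ∀ i j k l, dot h' (inner23 W i j) (inner23 W k l) = D i j k l := by
    intro i j k l
    simp only [dot, inner23, Matrix.of_apply, D, weylQuad]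
    refine Finset.sum_congr rfl fun p _ => Finset.sum_congr rfl fun q _ => ?_
    refine Finset.sum_congr rfl fun r _ => Finset.sum_congr rfl fun s _ => ?_
    rw [hWc.pair q k l s, hWc.swap12 l s q k, hWc.swap34 s l q k, neg_neg]
  have hform : ∀ m i, evalAt hs hz ((L.ginv * L.ric) m i) = ∑ p, h' p m * Ric i p := by
    intro m i
    rw [Matrix.mul_apply, map_sum]
    refine Finset.sum_congr rfl fun p _ => ?_
    rw [map_mul, ← invMetric_eq hs hz, ← ricci_eq hs hz]
    exact congrArg₂ _ (hsw m p) (hRics p i)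
  have hA : ∀ (f : Fin n → ℝ) (i : Fin n),
      ∑ m, evalAt hs hz ((L.ginv * L.ric) m i) * f m = ∑ p, ∑ q, h' p q * (Ric i p * f q) := by
    intro f i
    simp only [hform, Finset.sum_mul]
    rw [Finset.sum_comm]
    exact Finset.sum_congr rfl fun _ _ => Finset.sum_congr rfl fun _ _ => by ring
  have hB : ∀ i k c, ∑ p, ∑ q, h' p q * (Ric i p * Ric q k * c)
      = (RicM * h' * RicM) i k * c := by
    intro i k c
    simp only [Matrix.mul_apply, Finset.sum_mul, RicM, Matrix.of_apply]
    rw [Finset.sum_comm]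
    exact Finset.sum_congr rfl fun _ _ => Finset.sum_congr rfl fun _ _ => by ring
  have hN : ricciNormSq (F.G s) z = dot h' RicM RicM := by
    simp only [ricciNormSq, dot]
    refine Finset.sum_congr rfl fun p _ => ?_
    rw [Finset.sum_comm]
    rfl
  have hginv : h' = Matrix.of fun a b => evalAt hs hz (L.ginv a b) := by
    ext a b; exact invMetric_eq hs hz a b
  have hTe : T = fun i j k l => evalAt hs hz (L.rm i j k l) := by
    funext i j k l; exact riem_eq hs hz i j k l
  have hQuad : ∀ i j k l, evalAt hs hz (hamiltonQuad L.ginv L.rm i j k l)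
      = hamiltonQuad h' T i j k l := by
    intro i j k l
    simp only [hginv, hTe, hamiltonQuad, dot, inner23, Matrix.of_apply, map_mul, map_sub, map_add,
      map_sum, map_ofNat]
  have hev := congrArg (evalAt hs hz) (hflow.cov4_weylTensor_sub_lap4 (1 / ((n : ℝ) - 2))
    (1 / (2 * ((n : ℝ) - 1) * ((n : ℝ) - 2))) i j k l)
  have hcov : evalAt hs hz ((L.timeConn F.dt).cov4 F.weylFun i j k l)
      = evalAt hs hz (F.dt (F.weylFun i j k l)) + ∑ p, ∑ q, h' p q * (Ric i p * W q j k l)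
        + ∑ p, ∑ q, h' p q * (Ric j p * W i q k l) + ∑ p, ∑ q, h' p q * (Ric k p * W i j q l)
        + ∑ p, ∑ q, h' p q * (Ric l p * W i j k q) := by
    rw [← hA, ← hA, ← hA, ← hA]
    simp only [Conn.cov4, LeviCivita.timeConn, Matrix.neg_apply, neg_mul, Finset.sum_neg_distrib,
      map_sub, map_neg, map_sum, map_mul, W, weyl_eq hs hz]
    ring
  have hrhs : evalAt hs hz (hamiltonQuad L.ginv L.rm i j k l
        - kn L.g ((1 / ((n : ℝ) - 2)) • trace24 L.ginv (hamiltonQuad L.ginv L.rm)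
            - (1 / (2 * ((n : ℝ) - 1) * ((n : ℝ) - 2))) •
              (trace2 L.ginv (trace24 L.ginv (hamiltonQuad L.ginv L.rm)) • L.g)) i j k l)
      = hamiltonQuad h' T i j k l
        - kn h ((1 / ((n : ℝ) - 2)) • trace24 h' (hamiltonQuad h' T)
            - (1 / (2 * ((n : ℝ) - 1) * ((n : ℝ) - 2))) •
              (trace2 h' (trace24 h' (hamiltonQuad h' T)) • h)) i j k l := by
    have e : ∀ a b, evalAt hs hz (L.ginv a b) = h' a b := fun a b => (invMetric_eq hs hz a b).symm
    have e' : ∀ a b, evalAt hs hz (L.g a b) = h a b := fun a b => rfl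
    simp only [map_sub, hQuad, kn, map_add, map_mul, Matrix.sub_apply, Matrix.smul_apply, map_smul,
      smul_eq_mul, e', trace2, trace24, Matrix.of_apply, map_sum, e]
  rw [map_sub, hrhs, hreact] at hev
  change evalAt hs hz ((L.timeConn F.dt).cov4 F.weylFun i j k l)
    - evalAt hs hz (L.lap4 F.weylFun i j k l) = _ at hev
  rw [hcov, ← laplacianWeyl_eq hs hz, ← hN] at hev
  simp only [hamiltonQuad, hD, kn] at hev
  simp only [mul_add _ _ (_ : ℝ), mul_sub, Finset.sum_add_distrib, Finset.sum_sub_distrib, hB]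
  simp only [RicM, Matrix.of_apply] at hev ⊢
  linear_combination -hev

end MetricFamily

/-! ### Metrics on a manifold in a chart -/

section Chart

variable {n : ℕ} {M : Type*} [TopologicalSpace M] [ChartedSpace (Coord n) M]
  {φ : OpenPartialHomeomorph M (Coord n)}

/-- The differential of the inverse of a chart is injective. -/
lemma mfderiv_symm_injective (hφ : φ ∈ IsManifold.maximalAtlas (𝓡 n) ∞ M) {y : Coord n}
    (hy : y ∈ φ.target) : Function.Injective (mfderiv (𝓡 n) (𝓡 n) φ.symm y) := by
  have h1 : MDifferentiableAt (𝓡 n) (𝓡 n) φ.symm y :=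
    (contMDiffAt_symm_of_mem_maximalAtlas hφ hy).mdifferentiableAt (by simp)
  have h2 : MDifferentiableAt (𝓡 n) (𝓡 n) φ (φ.symm y) :=
    ((contMDiffOn_of_mem_maximalAtlas hφ).contMDiffAt
      (φ.open_source.mem_nhds (φ.map_target hy))).mdifferentiableAt (by simp)
  have h3 : φ ∘ φ.symm =ᶠ[nhds y] id := by
    filter_upwards [φ.open_target.mem_nhds hy] with z hz
    exact φ.right_inv hz
  have h4 := mfderiv_comp y h2 h1
  rw [h3.mfderiv_eq, mfderiv_id] at h4
  intro v w hvw
  have h5 := fun u => DFunLike.congr_fun h4 u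
  have := (h5 v).trans ((congrArg (mfderiv (𝓡 n) (𝓡 n) φ (φ.symm y)) hvw).trans (h5 w).symm)
  exact this

variable [IsManifold (𝓡 n) ∞ M]

lemma coeff_transpose (g : RiemMetric n M) (y : Coord n) : (coeff g φ y)ᵀ = coeff g φ y := by
  ext i j
  exact g.symm _ _ _

/-- The matrix of a metric in a chart is nondegenerate. -/
lemma det_coeff_ne_zero (g : RiemMetric n M) (hφ : φ ∈ IsManifold.maximalAtlas (𝓡 n) ∞ M)
    {y : Coord n} (hy : y ∈ φ.target) : (coeff g φ y).det ≠ 0 := by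
  intro h0
  obtain ⟨v, hv, hv0⟩ := Matrix.exists_mulVec_eq_zero_iff.2 h0
  let X : Coord n := WithLp.toLp 2 v
  let w : TangentSpace (𝓡 n) (φ.symm y) := mfderiv (𝓡 n) (𝓡 n) φ.symm y X
  have hX : X = ∑ i, v i • basisVec i := by
    ext k
    simp [X, basisVec, Pi.single_apply]
  have hw : w = ∑ i, v i • coordField φ y i := by
    simp only [w, hX, coordField]
    exact (map_sum (mfderiv (𝓡 n) (𝓡 n) φ.symm y) _ _).trans
      (Finset.sum_congr rfl fun i _ => map_smul (mfderiv (𝓡 n) (𝓡 n) φ.symm y) _ _)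
  have hww : g.inner (φ.symm y) w w = 0 := by
    have : g.inner (φ.symm y) w w = v ⬝ᵥ (coeff g φ y *ᵥ v) := by
      rw [hw]
      simp only [map_sum, map_smul, _root_.sum_apply, _root_.smul_apply,
        smul_eq_mul, dotProduct, Matrix.mulVec, coeff, Matrix.of_apply, Finset.mul_sum]
      rw [Finset.sum_comm]
      exact Finset.sum_congr rfl fun i _ => Finset.sum_congr rfl fun j _ => by ring
    rw [this, hv0, dotProduct_zero]
  have hw0 : w = 0 := by
    by_contra hne
    exact (g.pos _ w hne).ne' hww
  have hX0 : X = 0 := mfderiv_symm_injective hφ hy (hw0.trans (map_zero _).symm)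
  apply hv
  funext i
  exact congrArg (fun Y : Coord n => Y i) hX0

/-- A Ricci flow on a manifold, in a chart. -/
def chartFamily {I : Set ℝ} (hI : I.OrdConnected) (hI' : I.Nontrivial) {g : ℝ → RiemMetric n M}
    (hg : IsRicciFlow I g) (hφ : φ ∈ IsManifold.maximalAtlas (𝓡 n) ∞ M) : MetricFamily n where
  I := I
  U := φ.target
  G s := coeff (g s) φ
  ordConnected := hI
  nontrivial := hI'
  isOpen := φ.open_target
  smooth := hg.smooth φ hφ
  symm s _ _ _ := coeff_transpose (g s) _
  det_ne_zero s _ _ hz := det_coeff_ne_zero (g s) hφ hz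

end Chart

end WeylFlow

end

theorem mainTheorem1 {n : ℕ} (hn : 3 ≤ n) {M : Type*} [TopologicalSpace M]
    [ChartedSpace (WeylFlow.Coord n) M] [IsManifold (𝓡 n) ∞ M]
    {I : Set ℝ} (hI : I.OrdConnected) (hI' : I.Nontrivial)
    (g : ℝ → WeylFlow.RiemMetric n M) (hg : WeylFlow.IsRicciFlow I g)
    (φ : OpenPartialHomeomorph M (WeylFlow.Coord n))
    (hφ : φ ∈ IsManifold.maximalAtlas (𝓡 n) ∞ M)
    (t : ℝ) (ht : t ∈ I) (y : WeylFlow.Coord n) (hy : y ∈ φ.target) (i j k l : Fin n) :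
    let G : ℝ → WeylFlow.Coord n → Matrix (Fin n) (Fin n) ℝ := fun s => WeylFlow.coeff (g s) φ
    let W := WeylFlow.weyl (G t) y
    let D := WeylFlow.weylQuad (G t) y
    let Ric := WeylFlow.ricci (G t) y
    let R := WeylFlow.scalarCurv (G t) y
    let h := G t y
    let h' := WeylFlow.invMetric (G t) y
    HasDerivWithinAt (fun s => WeylFlow.weyl (G s) y i j k l)
      (WeylFlow.laplacianWeyl (G t) y i j k l
        + 2 * (D i j k l - D i j l k + D i k j l - D i l j k)
        - ∑ p, ∑ q, h' p q *
            (Ric i p * W q j k l + Ric j p * W i q k l + Ric k p * W i j q l + Ric l p * W i j k q)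
        + 2 / ((n : ℝ) - 2) ^ 2 * ∑ p, ∑ q, h' p q *
            (Ric i p * Ric q k * h j l - Ric i p * Ric q l * h j k
              + Ric j p * Ric q l * h i k - Ric j p * Ric q k * h i l)
        - 2 * R / ((n : ℝ) - 2) ^ 2 *
            (Ric i k * h j l - Ric i l * h j k + Ric j l * h i k - Ric j k * h i l)
        + 2 / ((n : ℝ) - 2) * (Ric i k * Ric j l - Ric j k * Ric i l)
        + 2 * (R ^ 2 - WeylFlow.ricciNormSq (G t) y) / (((n : ℝ) - 1) * ((n : ℝ) - 2) ^ 2) *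
            (h i k * h j l - h i l * h j k))
      I t := by
  exact WeylFlow.MetricFamily.IsRicciFlow.hasDerivWithinAt_weyl
    (F := WeylFlow.chartFamily hI hI' hg hφ) (hg.evolution φ hφ) hn ht hy i j k l
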